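/- Let $T>0$ and let $a,b,c\colon[0,T]\to\mathbb R$ be measurable functions satisfying the following conditions. (1) $a$ is nondecreasing; $b$ is absolutely continuous on $[\varepsilon,T]$ for every $\varepsilon\in(0,T)$ (with a.e. derivative $b'$); $ab$ is bounded on $[0,T]$; $c\in L^2([0,T])$; and $$\int_0^T\!\!\int_0^T |b'(u)|\,|b'(z)|\int_0^{u\wedge z} a^2(s)\,|c(u-s)|\,|c(z-s)|\,ds\,du\,dz<\infty .$$ (2) $a$ and $b$ are positive almost everywhere on $[0,T]$. (3) $c$ creates a Sonine pair with some $h\in L^1([0,T])$, that is, $\int_0^t c(t-s)h(s)\,ds=1$ for every $t\in(0,T]$. (4) There is a constant $C_1$ such that $|a(t)b'(t)|\le C_1t^{-1}$ for almost every $t\in[0,T]$. (5) There are $\gamma\in(0,2)$ and a constant $C_2$ such that, for all $t\in[0,T]$, $$\int_0^t c^2(s)\,ds\le C_2t^\gamma\qquad\text{and}\qquad \int_0^{T-t}\bigl(c(t+s)-c(s)\bigr)^2ds\le C_2t^\gamma .$$ For $0\le s\le t\le T$ put $$K(t,s)=a(s)\left[b(t)c(t-s)-\int_s^t b'(u)c(u-s)\,du\right].$$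 Then there is a constant $C$, depending only on $T,a,b,c,\gamma$, such that for every Wiener process $W=\{W_t,\ t\in[0,T]\}$ on a probability space the process $Y_t=\int_0^tK(t,s)\,dW_s$, $t\in[0,T]$ (a Wiener integral for each $t$, determined up to almost sure equality) is well defined, and $$\mathbf E\,(Y_{t_2}-Y_{t_1})^2\le C\,(t_2-t_1)^\gamma\qquad\text{for all } 0\le t_1\le t_2\le T .$$ Moreover, $Y$ has a modification such that, almost surely, its trajectories are $\delta$-Hölder continuous on $[0,T]$ for every $\delta\in(0,\gamma/2)$. -/

import Mathlib

open MeasureTheory ProbabilityTheory Filter Set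
open scoped Topology ENNReal NNReal

/-- A (standard) Wiener process on `[0, T]`: it starts from zero, has independent Gaussian
increments `W t - W s ∼ N(0, t - s)` and almost surely continuous paths. -/
structure IsWienerProcess {Ω : Type*} [MeasurableSpace Ω] {T : ℝ}
    (W : Icc (0 : ℝ) T → Ω → ℝ) (P : Measure Ω) : Prop where
  start_zero : ∀ t : Icc (0 : ℝ) T, (t : ℝ) = 0 → ∀ᵐ ω ∂P, W t ω = 0
  indep_increments : HasIndepIncrements W P
  law_increment : ∀ s t : Icc (0 : ℝ) T, s ≤ t →
    HasLaw (W t - W s) (gaussianReal 0 (Real.toNNReal ((t : ℝ) - (s : ℝ)))) P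
  continuous_paths : ∀ᵐ ω ∂P, Continuous fun t => W t ω

/-- Data of a step function on `[0, T]`: finitely many intervals `(left i, right i]` (not
necessarily disjoint) with real coefficients. -/
structure StepFunction (T : ℝ) where
  size : ℕ
  coef : Fin size → ℝ
  left : Fin size → Icc (0 : ℝ) T
  right : Fin size → Icc (0 : ℝ) T
  left_le_right : ∀ i, left i ≤ right i

namespace StepFunction

/-- The step function `∑ xᵢ 1_{(lᵢ, rᵢ]}`. -/
noncomputable def eval {T : ℝ} (φ : StepFunction T) (s : ℝ) : ℝ :=
  ∑ i, (Ioc (φ.left i : ℝ) (φ.right i : ℝ)).indicator (fun _ => φ.coef i) s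

/-- The elementary integral `∑ xᵢ (W_{rᵢ} - W_{lᵢ})` of a step function. -/
noncomputable def integral {Ω : Type*} {T : ℝ} (φ : StepFunction T)
    (W : Icc (0 : ℝ) T → Ω → ℝ) (ω : Ω) : ℝ :=
  ∑ i, φ.coef i * (W (φ.right i) ω - W (φ.left i) ω)

end StepFunction

/-- `X` is (a version of) the Wiener integral `∫₀ᵀ f(s) dW_s` of `f ∈ L²([0,T])`: the
`L²(P)`-limit of elementary integrals of step functions that converge to `f` in `L²([0,T])`. -/
def IsWienerIntegral {Ω : Type*} [MeasurableSpace Ω] {T : ℝ}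
    (W : Icc (0 : ℝ) T → Ω → ℝ) (P : Measure Ω) (f : ℝ → ℝ) (X : Ω → ℝ) : Prop :=
  MemLp f 2 (volume.restrict (Icc 0 T)) ∧ MemLp X 2 P ∧
    ∃ φ : ℕ → StepFunction T,
      Tendsto (fun n => eLpNorm (fun s => (φ n).eval s - f s) 2 (volume.restrict (Icc 0 T)))
        atTop (𝓝 0) ∧
      Tendsto (fun n => eLpNorm (fun ω => (φ n).integral W ω - X ω) 2 P) atTop (𝓝 0)

/-- `Y` is (a version of) the Volterra process `Y t = ∫₀ᵗ K(t,s) dW_s`, `t ∈ [0,T]`. -/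
def IsVolterraProcess {Ω : Type*} [MeasurableSpace Ω] {T : ℝ}
    (W : Icc (0 : ℝ) T → Ω → ℝ) (P : Measure Ω) (K : ℝ → ℝ → ℝ)
    (Y : Icc (0 : ℝ) T → Ω → ℝ) : Prop :=
  ∀ t : Icc (0 : ℝ) T, IsWienerIntegral W P ((Icc (0 : ℝ) (t : ℝ)).indicator (K t)) (Y t)

/-- The kernel `K(t,s) = a(s) [b(t) c(t-s) - ∫ₛᵗ b'(u) c(u-s) du]`, for `0 ≤ s ≤ t`. -/
noncomputable def sonineKernel (a b c : ℝ → ℝ) (t s : ℝ) : ℝ :=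
  a s * (b t * c (t - s) - ∫ u in s..t, deriv b u * c (u - s))

/-- `c` creates a Sonine pair with `h` on the interval `[0, T]`. (At `t = 0` the integral is
always zero, so the identity can only be required for `t ∈ (0, T]`.) -/
def IsSoninePair (T : ℝ) (c h : ℝ → ℝ) : Prop :=
  IntegrableOn h (Icc 0 T) ∧ ∀ t ∈ Ioc (0 : ℝ) T, ∫ s in (0 : ℝ)..t, c (t - s) * h s = 1

/-- First condition. Absolute continuity of `b` is required on each `[ε, T]` with `0 < ε < T`, so
that `b` may be singular at the origin, like `b(s) = s ^ (H - 1/2)` with `H < 1/2`. -/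
structure HatC1 (T : ℝ) (a b c : ℝ → ℝ) : Prop where
  monotone_a : MonotoneOn a (Icc 0 T)
  absolutelyContinuous_b : ∀ ε ∈ Ioo (0 : ℝ) T, AbsolutelyContinuousOnInterval b ε T
  bounded_ab : ∃ M : ℝ, ∀ t ∈ Icc (0 : ℝ) T, |a t * b t| ≤ M
  memLp_c : MemLp c 2 (volume.restrict (Icc 0 T))
  finite_A : ∫⁻ u in Icc 0 T, ∫⁻ z in Icc 0 T,
    ENNReal.ofReal (|deriv b u| * |deriv b z|) *
      ∫⁻ s in Icc 0 (min u z), ENNReal.ofReal (a s ^ 2 * |c (u - s)| * |c (z - s)|) < ∞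

/-- Second condition: `a` and `b` are positive almost everywhere on `[0, T]`. -/
def HatC2 (T : ℝ) (a b : ℝ → ℝ) : Prop :=
  ∀ᵐ t ∂(volume.restrict (Icc 0 T)), 0 < a t ∧ 0 < b t

/-- Third condition: `c` creates a Sonine pair with some integrable `h`. -/
def HatC3 (T : ℝ) (c : ℝ → ℝ) : Prop := ∃ h : ℝ → ℝ, IsSoninePair T c h

/-- Fourth condition: `|a(t) b'(t)| ≤ C / t`, for almost every `t`, as `b'` exists only
almost everywhere. -/
def HatC4 (T : ℝ) (a b : ℝ → ℝ) : Prop :=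
  ∃ C : ℝ, ∀ᵐ t ∂(volume.restrict (Icc 0 T)), |a t * deriv b t| ≤ C * t⁻¹

/-- Fifth condition, for a given exponent `γ ∈ (0, 2)`. -/
structure HatC5 (T γ : ℝ) (c : ℝ → ℝ) : Prop where
  exponent_mem : γ ∈ Ioo (0 : ℝ) 2
  integral_sq_le : ∃ C : ℝ, ∀ t ∈ Icc (0 : ℝ) T, ∫ s in (0 : ℝ)..t, c s ^ 2 ≤ C * t ^ γ
  integral_sq_sub_le : ∃ C : ℝ, ∀ t ∈ Icc (0 : ℝ) T,
    ∫ s in (0 : ℝ)..(T - t), (c (t + s) - c s) ^ 2 ≤ C * t ^ γ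

/-! Put `β = γ / 2`. Everything rests on one deterministic fact: `t ↦ K(t, ·) 1_{[0,t]}` is
`β`-Hölder from `[0, T]` to `L²([0, T])` (`eLpNorm_indicator_sub_le`). The Itô isometry turns it
into the variance bound. Increments of `Y` are `L²` limits of centered Gaussian variables, so every
moment is controlled by the variance and inherits the exponent `β`; a dyadic Kolmogorov argument
with arbitrarily high moments then gives all Hölder orders below `β`.

For the kernel, `a` is positive on `(0, T]` and nondecreasing, so for `s ≤ u` one has `a(s)|b(u)| ≤
a(u)|b(u)| ≤ M` and `a(s)|b'(u)| ≤ C / u`. Minkowski's inequality in `u` reduces each integral term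
to `L²` norms of `c` and of its translation differences, which are at most `κ` times the `β`-th
power of the length.

For `x ≤ t` with `t - x ≤ x`, two pieces are estimated. On `(x, t]`, the singularity `1 / u` is
weaker than `1 / (u - x)`, and `(u - x)^(β - 1)` is integrable (`eLpNorm_sonineKernel_le`). On `(0,
x]`, writing `b(t) = b(x) + ∫ b'` leaves only differences of `c`, while `1 / u ≤ 1 / (t - x)`
(`eLpNorm_sonineKernel_sub_le`). If instead `x ≤ t - x`, then `t ≤ 2 (t - x)` and it suffices to
bound the two kernels separately. -/

/-! ### Moments of centered Gaussian variables -/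

theorem eLpNorm_two_eq_ofReal_sqrt {α : Type*} [MeasurableSpace α] {μ : Measure α} {f : α → ℝ}
    (hf : MemLp f 2 μ) : eLpNorm f 2 μ = ENNReal.ofReal √(∫ x, f x ^ 2 ∂μ) := by
  rw [hf.eLpNorm_eq_integral_rpow_norm (by norm_num) (by norm_num), Real.sqrt_eq_rpow]
  norm_num

theorem eLpNorm_gaussianReal_zero {v : ℝ≥0} {p : ℝ≥0∞} :
    eLpNorm id p (gaussianReal 0 v) =
      ENNReal.ofReal √v * eLpNorm id p (gaussianReal 0 1) := by
  have h := gaussianReal_map_const_mul (μ := 0) (v := 1) √v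
  have h2 : NNReal.mk (√(v : ℝ) ^ 2) (sq_nonneg _) * 1 = v := by
    ext; simp
  rw [h2, mul_zero] at h
  rw [← h, eLpNorm_map_measure (by fun_prop) (by fun_prop)]
  have : (id ∘ fun x : ℝ => √(v : ℝ) * x) = √(v : ℝ) • (id : ℝ → ℝ) := by ext; simp
  rw [this, eLpNorm_const_smul, Real.enorm_of_nonneg (Real.sqrt_nonneg _)]

theorem eLpNorm_two_gaussianReal_zero_one : eLpNorm id 2 (gaussianReal 0 1) = 1 := by
  rw [eLpNorm_two_eq_ofReal_sqrt (memLp_id_gaussianReal 2)]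
  have h := variance_fun_id_gaussianReal (μ := 0) (v := 1)
  rw [variance_eq_integral measurable_id'.aemeasurable] at h
  simp only [integral_id_gaussianReal] at h
  simp_all

/-- All absolute moments of a centered Gaussian variable are controlled by its variance. -/
theorem ProbabilityTheory.HasGaussianLaw.eLpNorm_le {Ω : Type*} [MeasurableSpace Ω]
    {P : Measure Ω} {X : Ω → ℝ} (hX : HasGaussianLaw X P) (h0 : ∫ ω, X ω ∂P = 0) (p : ℝ≥0∞) :
    eLpNorm X p P ≤ eLpNorm id p (gaussianReal 0 1) * eLpNorm X 2 P := by
  have key (q : ℝ≥0∞) : eLpNorm X q P =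
      ENNReal.ofReal √(Var[X; P].toNNReal) * eLpNorm id q (gaussianReal 0 1) := by
    rw [← eLpNorm_gaussianReal_zero, ← h0, ← hX.map_eq_gaussianReal,
      eLpNorm_map_measure (by fun_prop) hX.aemeasurable]
    rfl
  rw [key p, key 2, eLpNorm_two_gaussianReal_zero_one, mul_one, mul_comm]

/-! ### Elementary integrals of step functions and their isometry -/

namespace StepFunction

variable {Ω : Type*} {T : ℝ}

/-- The difference of two step functions. -/
def sub (φ ψ : StepFunction T) : StepFunction T where
  size := φ.size + ψ.size
  coef := Fin.append φ.coef (fun i => -ψ.coef i)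
  left := Fin.append φ.left ψ.left
  right := Fin.append φ.right ψ.right
  left_le_right i := by
    refine Fin.addCases (fun j => ?_) (fun j => ?_) i
    · simpa using φ.left_le_right j
    · simpa using ψ.left_le_right j

theorem eval_sub (φ ψ : StepFunction T) (s : ℝ) :
    (φ.sub ψ).eval s = φ.eval s - ψ.eval s := by
  refine (Fin.sum_univ_add (a := φ.size) (b := ψ.size) _).trans ?_
  simp only [eval, sub, Fin.append_left, Fin.append_right]
  rw [sub_eq_add_neg, ← Finset.sum_neg_distrib]
  congr 1
  refine Finset.sum_congr rfl fun i _ => ?_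
  simp only [indicator]
  split_ifs <;> simp

theorem integral_sub (φ ψ : StepFunction T) (W : Icc (0 : ℝ) T → Ω → ℝ) (ω : Ω) :
    (φ.sub ψ).integral W ω = φ.integral W ω - ψ.integral W ω := by
  refine (Fin.sum_univ_add (a := φ.size) (b := ψ.size) _).trans ?_
  simp only [integral, sub, Fin.append_left, Fin.append_right]
  rw [sub_eq_add_neg, ← Finset.sum_neg_distrib]
  congr 1
  refine Finset.sum_congr rfl fun i _ => ?_
  ring

theorem memLp_eval (φ : StepFunction T) (μ : Measure ℝ) [IsFiniteMeasure μ] (p : ℝ≥0∞) :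
    MemLp φ.eval p μ := by
  unfold eval
  exact memLp_finsetSum _ fun i _ => (memLp_const (φ.coef i)).indicator measurableSet_Ioc

end StepFunction

namespace IsWienerProcess

variable {Ω : Type*} [MeasurableSpace Ω] {T : ℝ} {W : Icc (0 : ℝ) T → Ω → ℝ} {P : Measure Ω}

theorem hasGaussianLaw_sub_of_le (hW : IsWienerProcess W P) {s t : Icc (0 : ℝ) T} (h : s ≤ t) :
    HasGaussianLaw (W t - W s) P :=
  (hW.law_increment s t h).hasGaussianLaw

theorem memLp_sub (hW : IsWienerProcess W P) (s t : Icc (0 : ℝ) T) :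
    MemLp (fun ω => W t ω - W s ω) 2 P := by
  rcases le_total s t with h | h
  · exact (hW.hasGaussianLaw_sub_of_le h).memLp_two
  · convert (hW.hasGaussianLaw_sub_of_le h).memLp_two.neg using 1
    ext; simp

theorem integral_sub_eq_zero (hW : IsWienerProcess W P) {s t : Icc (0 : ℝ) T} (h : s ≤ t) :
    ∫ ω, (W t ω - W s ω) ∂P = 0 := by
  have := (hW.law_increment s t h).integral_eq
  simpa using this

theorem integral_sub_sq (hW : IsWienerProcess W P) (s t : Icc (0 : ℝ) T) :
    ∫ ω, (W t ω - W s ω) ^ 2 ∂P = |(t : ℝ) - s| := by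
  wlog h : s ≤ t generalizing s t
  · rw [abs_sub_comm, ← this t s (le_of_not_ge h)]
    congr 1; ext; ring
  have := (hW.law_increment s t h).integral_comp (f := fun x : ℝ => x ^ 2) (by fun_prop)
  simp only [Function.comp_def, Pi.sub_apply] at this
  rw [this]
  have h' := variance_fun_id_gaussianReal (μ := 0) (v := ((t : ℝ) - s).toNNReal)
  rw [variance_eq_integral measurable_id'.aemeasurable] at h'
  simp only [integral_id_gaussianReal, sub_zero] at h'
  have h2 : (0 : ℝ) ≤ t - s := sub_nonneg.2 h
  rw [h', abs_of_nonneg h2, Real.coe_toNNReal _ h2]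

/-- Polarization: the product of two increments is a linear combination of four squared increments,
so variances alone determine the covariance. Independence enters only through joint Gaussianity. -/
theorem integral_sub_mul_sub (hW : IsWienerProcess W P) (s t u v : Icc (0 : ℝ) T) :
    ∫ ω, (W t ω - W s ω) * (W v ω - W u ω) ∂P =
      (|(t : ℝ) - u| + |(s : ℝ) - v| - |(t : ℝ) - v| - |(s : ℝ) - u|) / 2 := by
  have I (x y : Icc (0 : ℝ) T) : Integrable (fun ω => (W y ω - W x ω) ^ 2) P :=
    (hW.memLp_sub x y).integrable_sq
  rw [← hW.integral_sub_sq u t, ← hW.integral_sub_sq v s, ← hW.integral_sub_sq v t,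
    ← hW.integral_sub_sq u s, ← integral_add (I _ _) (I _ _),
    ← integral_sub (by exact (I _ _).add (I _ _)) (I _ _),
    ← integral_sub (by exact ((I _ _).add (I _ _)).sub (I _ _)) (I _ _), ← integral_div]
  congr 1; ext ω
  ring

theorem memLp_integral (hW : IsWienerProcess W P) (φ : StepFunction T) :
    MemLp (φ.integral W) 2 P := by
  unfold StepFunction.integral
  exact memLp_finsetSum _ fun i _ => (hW.memLp_sub _ _).const_mul _

/-- The length of the overlap of two intervals, put in the same four-distance form as the covariance
of increments, so that the isometry can be compared term by term even for overlapping intervals. -/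
theorem integral_indicator_mul_indicator {l r l' r' : Icc (0 : ℝ) T} (h : l ≤ r) (h' : l' ≤ r')
    (x y : ℝ) :
    ∫ s in Icc 0 T, (Ioc (l : ℝ) r).indicator (fun _ => x) s *
        (Ioc (l' : ℝ) r').indicator (fun _ => y) s =
      x * y * ((|(r : ℝ) - l'| + |(l : ℝ) - r'| - |(r : ℝ) - r'| - |(l : ℝ) - l'|) / 2) := by
  obtain ⟨l, hl⟩ := l
  obtain ⟨r, hr⟩ := r
  obtain ⟨l', hl'⟩ := l'
  obtain ⟨r', hr'⟩ := r'
  simp only [Subtype.mk_le_mk] at *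
  have h1 : (fun s => (Ioc l r).indicator (fun _ => x) s * (Ioc l' r').indicator (fun _ => y) s)
      = (Ioc (max l l') (min r r')).indicator (fun _ => x * y) := by
    ext s
    rw [← Ioc_inter_Ioc, inter_indicator_mul]
  rw [h1, integral_indicator measurableSet_Ioc, Measure.restrict_restrict measurableSet_Ioc,
    inter_eq_left.2, setIntegral_const, smul_eq_mul, measureReal_def, Real.volume_Ioc,
    ENNReal.toReal_ofReal', mul_comm]
  · congr 1
    grind
  · intro s hs
    simp only [mem_Ioc, max_lt_iff, le_min_iff] at hs
    exact ⟨by linarith [hl.1], by linarith [hr.2]⟩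

/-- The Itô isometry for step functions. -/
theorem integral_sq_integral (hW : IsWienerProcess W P) (φ : StepFunction T) :
    ∫ ω, φ.integral W ω ^ 2 ∂P = ∫ s in Icc 0 T, φ.eval s ^ 2 := by
  unfold StepFunction.integral StepFunction.eval
  simp only [sq, Finset.sum_mul_sum]
  have hi (i : Fin φ.size) : MemLp ((Ioc (φ.left i : ℝ) (φ.right i : ℝ)).indicator
      (fun _ => φ.coef i)) 2 (volume.restrict (Icc 0 T)) :=
    (memLp_const (φ.coef i)).indicator measurableSet_Ioc
  rw [integral_finsetSum, integral_finsetSum]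
  · refine Finset.sum_congr rfl fun i _ => ?_
    rw [integral_finsetSum, integral_finsetSum]
    · refine Finset.sum_congr rfl fun j _ => ?_
      rw [integral_indicator_mul_indicator (φ.left_le_right i) (φ.left_le_right j),
        ← hW.integral_sub_mul_sub, ← integral_const_mul]
      congr 1; ext; ring
    · exact fun j _ => (hi i).integrable_mul (hi j)
    · exact fun j _ => ((hW.memLp_sub _ _).const_mul _).integrable_mul
        ((hW.memLp_sub _ _).const_mul _)
  · exact fun i _ => integrable_finsetSum _ fun j _ => (hi i).integrable_mul (hi j)
  · exact fun i _ => integrable_finsetSum _ fun j _ =>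
      ((hW.memLp_sub _ _).const_mul _).integrable_mul ((hW.memLp_sub _ _).const_mul _)

theorem eLpNorm_integral (hW : IsWienerProcess W P) (φ : StepFunction T) :
    eLpNorm (φ.integral W) 2 P = eLpNorm φ.eval 2 (volume.restrict (Icc 0 T)) := by
  rw [eLpNorm_two_eq_ofReal_sqrt (hW.memLp_integral φ),
    eLpNorm_two_eq_ofReal_sqrt (φ.memLp_eval _ _), hW.integral_sq_integral]

theorem eLpNorm_integral_sub (hW : IsWienerProcess W P) (φ ψ : StepFunction T) :
    eLpNorm (fun ω => φ.integral W ω - ψ.integral W ω) 2 P =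
      eLpNorm (fun s => φ.eval s - ψ.eval s) 2 (volume.restrict (Icc 0 T)) := by
  simpa only [← StepFunction.eval_sub, ← StepFunction.integral_sub]
    using hW.eLpNorm_integral (φ.sub ψ)

theorem isGaussianProcess (hT : 0 ≤ T) (hW : IsWienerProcess W P) : IsGaussianProcess W P := by
  let z : Icc (0 : ℝ) T := ⟨0, le_refl 0, hT⟩
  -- The Gaussian criterion for independent increments starts the process at a bottom element of the
  -- index set, here the time `0`.
  let : OrderBot (Icc (0 : ℝ) T) := { bot := z, bot_le := fun t => t.2.1 }
  have h0 : ∀ᵐ ω ∂P, W z ω = 0 := hW.start_zero z rfl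
  refine HasIndepIncrements.isGaussianProcess (fun t => ?_) h0 hW.indep_increments
  refine (hW.hasGaussianLaw_sub_of_le (bot_le : z ≤ t)).congr ?_
  filter_upwards [h0] with ω h
  exact (congrArg (W t ω - ·) h).trans (sub_zero _)

theorem hasGaussianLaw_integral (hT : 0 ≤ T) (hW : IsWienerProcess W P) (φ : StepFunction T) :
    HasGaussianLaw (φ.integral W) P := by
  classical
  have hG := hW.isGaussianProcess hT
  let I : Finset (Icc (0 : ℝ) T) := Finset.univ.image φ.left ∪ Finset.univ.image φ.right
  have hl (i) : φ.left i ∈ I := by simp [I]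
  have hr (i) : φ.right i ∈ I := by simp [I]
  let L : (I → ℝ) →L[ℝ] ℝ := ∑ i, φ.coef i •
    (ContinuousLinearMap.proj (R := ℝ) (φ := fun _ : I => ℝ) ⟨φ.right i, hr i⟩ -
      ContinuousLinearMap.proj ⟨φ.left i, hl i⟩)
  have h := (hG.hasGaussianLaw I).map_fun L
  have h2 : (fun ω => L (I.restrict (W · ω))) = φ.integral W := by
    ext ω
    simp [L, StepFunction.integral]
  rwa [h2] at h

theorem integral_integral_eq_zero (hW : IsWienerProcess W P) [IsProbabilityMeasure P]
    (φ : StepFunction T) : ∫ ω, φ.integral W ω ∂P = 0 := by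
  unfold StepFunction.integral
  rw [integral_finsetSum _ fun i _ =>
    ((hW.memLp_sub _ _).integrable (by norm_num)).const_mul _]
  refine Finset.sum_eq_zero fun i _ => ?_
  rw [integral_const_mul, hW.integral_sub_eq_zero (φ.left_le_right i), mul_zero]

end IsWienerProcess

theorem tendsto_eLpNorm_of_tendsto_eLpNorm_sub {α : Type*} [MeasurableSpace α] {μ : Measure α}
    {p : ℝ≥0∞} (hp : 1 ≤ p) {u : ℕ → α → ℝ} {v : α → ℝ} (hu : ∀ n, MemLp (u n) p μ)
    (hv : MemLp v p μ) (h : Tendsto (fun n => eLpNorm (fun x => u n x - v x) p μ) atTop (𝓝 0)) :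
    Tendsto (fun n => eLpNorm (u n) p μ) atTop (𝓝 (eLpNorm v p μ)) := by
  have h1 : Tendsto (fun n => eLpNorm v p μ - eLpNorm (fun x => u n x - v x) p μ) atTop
      (𝓝 (eLpNorm v p μ)) := by
    simpa using ENNReal.Tendsto.sub (tendsto_const_nhds (x := eLpNorm v p μ)) h (Or.inr (by simp))
  have h2 : Tendsto (fun n => eLpNorm v p μ + eLpNorm (fun x => u n x - v x) p μ) atTop
      (𝓝 (eLpNorm v p μ)) := by
    simpa using (tendsto_const_nhds (x := eLpNorm v p μ)).add h
  refine tendsto_of_tendsto_of_tendsto_of_le_of_le h1 h2 (fun n => ?_) (fun n => ?_)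
  · refine tsub_le_iff_right.2 ?_
    have e : v = u n - fun x => u n x - v x := by ext; simp
    conv_lhs => rw [e]
    exact eLpNorm_sub_le (hu n).1 ((hu n).sub hv).1 hp
  · have e : u n = v + fun x => u n x - v x := by ext; simp
    conv_lhs => rw [e]
    exact eLpNorm_add_le hv.1 ((hu n).sub hv).1 hp

/-! ### Density of step functions in `L²` -/

namespace StepFunction

variable {T : ℝ}

/-- The cells are open on the left and closed on the right, hence the ceiling of `s / (T / N)` minus
one rather than the floor. -/
theorem exists_lt_le_of_mem_Ioc {N : ℕ} (hN : 0 < N) {s : ℝ} (hs : s ∈ Ioc 0 T) :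
    ∃ k < N, (k : ℝ) * (T / N) < s ∧ s ≤ (k + 1 : ℝ) * (T / N) := by
  have hT : 0 < T := hs.1.trans_le hs.2
  have hN' : (0 : ℝ) < N := by exact_mod_cast hN
  have hd : 0 < T / N := by positivity
  have hpos : 0 < s / (T / N) := div_pos hs.1 hd
  obtain ⟨m, hm⟩ := Nat.exists_eq_succ_of_ne_zero (Nat.ceil_pos.2 hpos).ne'
  refine ⟨m, ?_, ?_, ?_⟩
  · have : ⌈s / (T / N)⌉₊ ≤ N := by
      refine Nat.ceil_le.2 ((div_le_iff₀ hd).2 ?_)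
      have : (N : ℝ) * (T / N) = T := by field_simp
      rw [this]; exact hs.2
    omega
  · have h := Nat.ceil_lt_add_one hpos.le
    rw [hm] at h
    push_cast at h
    exact (lt_div_iff₀ hd).1 (by linarith)
  · have h := Nat.le_ceil (s / (T / N))
    rw [hm] at h
    push_cast at h
    exact (div_le_iff₀ hd).1 h

/-- The step function with `N` steps of equal length that samples `g` at the left end points. -/
noncomputable def sample (hT : 0 < T) (g : ℝ → ℝ) (N : ℕ) : StepFunction T where
  size := N
  coef i := g (i * (T / N))
  left i := ⟨i * (T / N), by positivity, by
    have hi : (i : ℝ) ≤ N := by exact_mod_cast i.2.le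
    have hN : (0 : ℝ) < N := by exact_mod_cast i.pos
    rw [← mul_div_assoc, div_le_iff₀ hN, mul_comm]
    gcongr⟩
  right i := ⟨(i + 1) * (T / N), by positivity, by
    have hi : (i : ℝ) + 1 ≤ N := by exact_mod_cast i.2
    have hN : (0 : ℝ) < N := by exact_mod_cast i.pos
    rw [← mul_div_assoc, div_le_iff₀ hN, mul_comm]
    gcongr⟩
  left_le_right i := by
    refine Subtype.mk_le_mk.2 ?_
    gcongr
    linarith

theorem eval_sample (hT : 0 < T) (g : ℝ → ℝ) {N k : ℕ} (hk : k < N) {s : ℝ}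
    (h1 : (k : ℝ) * (T / N) < s) (h2 : s ≤ (k + 1 : ℝ) * (T / N)) :
    (sample hT g N).eval s = g (k * (T / N)) := by
  have hN : (0 : ℝ) < N := by exact_mod_cast (Nat.zero_le k).trans_lt hk
  have hd : 0 < T / N := by positivity
  unfold eval
  refine (Finset.sum_eq_single (⟨k, hk⟩ : Fin N) (fun j _ hj => ?_)
    fun h => absurd (Finset.mem_univ _) h).trans ?_
  · refine indicator_of_notMem ?_ _
    rintro ⟨ha, hb⟩
    simp only [sample] at ha hb
    have ha' := lt_of_mul_lt_mul_right (ha.trans_le h2) hd.le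
    have hb' := lt_of_mul_lt_mul_right (h1.trans_le hb) hd.le
    have ha'' : (j : ℕ) < k + 1 := by exact_mod_cast ha'
    have hb'' : k < (j : ℕ) + 1 := by exact_mod_cast hb'
    exact hj (Fin.ext (by simp only; omega))
  · exact indicator_of_mem (show s ∈ Ioc ((k : ℝ) * (T / N)) ((k + 1) * (T / N)) from ⟨h1, h2⟩) _

/-- Uniform continuity on a mesh finer than the modulus. The point `0` is excluded because it lies
in no interval `(l, r]`; being null, it does not affect `L²` norms. -/
theorem exists_abs_eval_sub_le (hT : 0 < T) {g : ℝ → ℝ} (hg : Continuous g) {η : ℝ} (hη : 0 < η) :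
    ∃ φ : StepFunction T, ∀ s ∈ Ioc 0 T, |φ.eval s - g s| ≤ η := by
  have hu := isCompact_Icc (a := (0 : ℝ)) (b := T).uniformContinuousOn_of_continuous
    hg.continuousOn
  obtain ⟨δ, hδ, hu⟩ := Metric.uniformContinuousOn_iff.1 hu η hη
  obtain ⟨N, hN⟩ := exists_nat_gt (T / δ)
  have hN0 : (0 : ℝ) < N := (div_pos hT hδ).trans hN
  have hd : T / N < δ := by rwa [div_lt_comm₀ hN0 hδ]
  refine ⟨sample hT g N, fun s hs => ?_⟩
  obtain ⟨k, hk, h1, h2⟩ := exists_lt_le_of_mem_Ioc (by exact_mod_cast hN0 : 0 < N) hs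
  rw [eval_sample hT g hk h1 h2]
  have h0 : (0 : ℝ) ≤ k * (T / N) := by positivity
  refine (hu _ ⟨h0, h1.le.trans hs.2⟩ s ⟨hs.1.le, hs.2⟩ ?_).le
  rw [Real.dist_eq, abs_sub_comm, abs_of_pos (by linarith)]
  linarith

theorem exists_eLpNorm_sub_le (hT : 0 < T) {f : ℝ → ℝ}
    (hf : MemLp f 2 (volume.restrict (Icc 0 T))) {ε : ℝ≥0∞} (hε : ε ≠ 0) :
    ∃ φ : StepFunction T,
      eLpNorm (fun s => φ.eval s - f s) 2 (volume.restrict (Icc 0 T)) ≤ ε := by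
  have hε2 : ε / 2 ≠ 0 := by simpa using hε
  obtain ⟨g, hg, hgm⟩ := hf.exists_boundedContinuous_eLpNorm_sub_le (by norm_num) hε2
  obtain ⟨η, hη, hη'⟩ : ∃ η : ℝ, 0 < η ∧
      (volume.restrict (Icc 0 T)) univ ^ (2 : ℝ≥0∞).toReal⁻¹ * ENNReal.ofReal η ≤ ε / 2 := by
    have h1 : Tendsto (fun η : ℝ => (volume.restrict (Icc 0 T)) univ ^ (2 : ℝ≥0∞).toReal⁻¹ *
        ENNReal.ofReal η) (𝓝 0) (𝓝 0) := by
      have := ENNReal.Tendsto.const_mul (a := (volume.restrict (Icc 0 T)) univ ^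
        (2 : ℝ≥0∞).toReal⁻¹) (ENNReal.tendsto_ofReal (tendsto_id (x := 𝓝 (0 : ℝ))))
        (Or.inr (ENNReal.rpow_ne_top_of_nonneg (by simp) (by simp)))
      simpa using this
    have h2 := (h1.mono_left (nhdsWithin_le_nhds (s := Ioi (0 : ℝ)))).eventually_le_const (pos_iff_ne_zero.2 hε2)
    obtain ⟨η, h3, h4⟩ := (h2.and (self_mem_nhdsWithin (s := Ioi (0 : ℝ)))).exists
    exact ⟨η, h4, h3⟩
  obtain ⟨φ, hφ⟩ := exists_abs_eval_sub_le hT g.continuous hη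
  refine ⟨φ, ?_⟩
  have e : (fun s => φ.eval s - f s) = (φ.eval - g) - (f - g) := by ext; simp
  rw [e]
  refine (eLpNorm_sub_le ((φ.memLp_eval _ 2).sub hgm).1 (hf.sub hgm).1 (by norm_num)).trans ?_
  refine (add_le_add ?_ hg).trans_eq (ENNReal.add_halves ε)
  refine (eLpNorm_le_of_ae_bound ?_).trans hη'
  rw [Measure.restrict_congr_set Ioc_ae_eq_Icc.symm]
  filter_upwards [ae_restrict_mem measurableSet_Ioc] with s hs
  exact hφ s hs

end StepFunction

/-! ### Wiener integrals: existence, isometry, moments -/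

section WienerIntegral

variable {Ω : Type*} [MeasurableSpace Ω] {T : ℝ} {W : Icc (0 : ℝ) T → Ω → ℝ} {P : Measure Ω}
  {f g : ℝ → ℝ} {X Y : Ω → ℝ}

/-- Every square integrable function has a Wiener integral. -/
theorem IsWienerProcess.exists_isWienerIntegral (hT : 0 < T) (hW : IsWienerProcess W P)
    (hf : MemLp f 2 (volume.restrict (Icc 0 T))) : ∃ X, IsWienerIntegral W P f X := by
  -- Dividing by `4` makes the sum of two errors at most `2⁻¹ ^ N / 2`, strictly below the summable
  -- bound `2⁻¹ ^ N` of the completeness criterion.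
  have hB0 (n : ℕ) : ((2 : ℝ≥0∞)⁻¹ ^ n / 4) ≠ 0 := by simp
  choose φ hφ using fun n : ℕ => StepFunction.exists_eLpNorm_sub_le hT hf (hB0 n)
  have hpow (n : ℕ) : (2 : ℝ≥0∞)⁻¹ ^ n ≠ ∞ := ENNReal.pow_ne_top (by simp)
  have hlim : Tendsto (fun n : ℕ => (2 : ℝ≥0∞)⁻¹ ^ n / 4) atTop (𝓝 0) := by
    have := ENNReal.Tendsto.div_const (b := 4) (ENNReal.tendsto_pow_atTop_nhds_zero_of_lt_one
      (r := (2 : ℝ≥0∞)⁻¹) (by simp)) (Or.inr (by norm_num))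
    simpa using this
  obtain ⟨X, hX, hXlim⟩ := Lp.cauchy_complete_eLpNorm (μ := P) (p := 2) (by norm_num)
    (f := fun n => (φ n).integral W) (fun n => hW.memLp_integral (φ n))
    (B := fun n => (2 : ℝ≥0∞)⁻¹ ^ n)
    (by rw [ENNReal.tsum_geometric]; simp) (fun N n m hn hm => by
      have e : (fun s => (φ n).eval s - (φ m).eval s) =
          (fun s => (φ n).eval s - f s) - fun s => (φ m).eval s - f s := by ext; simp
      refine (hW.eLpNorm_integral_sub (φ n) (φ m)).trans_lt ?_
      rw [e]
      refine (eLpNorm_sub_le (((φ n).memLp_eval _ 2).sub hf).1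
        (((φ m).memLp_eval _ 2).sub hf).1 (by norm_num)).trans_lt ?_
      have hle {k : ℕ} (hk : N ≤ k) : (2 : ℝ≥0∞)⁻¹ ^ k / 4 ≤ 2⁻¹ ^ N / 4 := by
        gcongr ?_ / 4
        exact pow_le_pow_of_le_one (by simp) (by simp) hk
      refine (add_le_add ((hφ n).trans (hle hn)) ((hφ m).trans (hle hm))).trans_lt ?_
      have : (2 : ℝ≥0∞)⁻¹ ^ N / 4 + 2⁻¹ ^ N / 4 = 2⁻¹ ^ N / 2 := by
        rw [← two_mul, div_eq_mul_inv, div_eq_mul_inv, mul_left_comm]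
        congr 1
        rw [show (4 : ℝ≥0∞) = 2 * 2 by norm_num, ENNReal.mul_inv (by simp) (by simp), ← mul_assoc,
          ENNReal.mul_inv_cancel (by simp) (by simp), one_mul]
      rw [this]
      exact ENNReal.half_lt_self (by simp) (hpow N))
  exact ⟨X, hf, hX, φ, tendsto_of_tendsto_of_tendsto_of_le_of_le tendsto_const_nhds hlim
    (fun _ => zero_le) hφ, hXlim⟩

/-- The difference of two Wiener integrals is an `L²` limit of integrals of step functions which
converge to the difference of the integrands. -/
theorem IsWienerIntegral.exists_tendsto_sub (hW : IsWienerProcess W P)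
    (hX : IsWienerIntegral W P f X) (hY : IsWienerIntegral W P g Y) :
    ∃ φ : ℕ → StepFunction T,
      Tendsto (fun n => eLpNorm (fun s => (φ n).eval s - (f s - g s)) 2
        (volume.restrict (Icc 0 T))) atTop (𝓝 0) ∧
      Tendsto (fun n => eLpNorm (fun ω => (φ n).integral W ω - (X ω - Y ω)) 2 P)
        atTop (𝓝 0) := by
  obtain ⟨hf, hXm, φ, hφ, hφX⟩ := hX
  obtain ⟨hg, hYm, ψ, hψ, hψY⟩ := hY
  have h1 := hφ.add hψ
  have h2 := hφX.add hψY
  rw [add_zero] at h1 h2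
  refine ⟨fun n => (φ n).sub (ψ n), ?_, ?_⟩
  · refine tendsto_of_tendsto_of_tendsto_of_le_of_le tendsto_const_nhds h1 (fun _ => zero_le)
      fun n => ?_
    have e : (fun s => ((φ n).sub (ψ n)).eval s - (f s - g s)) =
        (fun s => (φ n).eval s - f s) - fun s => (ψ n).eval s - g s := by
      ext s; simp only [StepFunction.eval_sub, Pi.sub_apply]; ring
    rw [e]
    exact eLpNorm_sub_le (((φ n).memLp_eval _ 2).sub hf).1 (((ψ n).memLp_eval _ 2).sub hg).1
      (by norm_num)
  · refine tendsto_of_tendsto_of_tendsto_of_le_of_le tendsto_const_nhds h2 (fun _ => zero_le)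
      fun n => ?_
    have e : (fun ω => ((φ n).sub (ψ n)).integral W ω - (X ω - Y ω)) =
        (fun ω => (φ n).integral W ω - X ω) - fun ω => (ψ n).integral W ω - Y ω := by
      ext s; simp only [StepFunction.integral_sub, Pi.sub_apply]; ring
    rw [e]
    exact eLpNorm_sub_le ((hW.memLp_integral (φ n)).sub hXm).1
      ((hW.memLp_integral (ψ n)).sub hYm).1 (by norm_num)

/-- The Itô isometry for differences of Wiener integrals. -/
theorem IsWienerIntegral.eLpNorm_sub (hW : IsWienerProcess W P)
    (hX : IsWienerIntegral W P f X) (hY : IsWienerIntegral W P g Y) :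
    eLpNorm (fun ω => X ω - Y ω) 2 P =
      eLpNorm (fun s => f s - g s) 2 (volume.restrict (Icc 0 T)) := by
  obtain ⟨φ, h1, h2⟩ := hX.exists_tendsto_sub hW hY
  have h3 := tendsto_eLpNorm_of_tendsto_eLpNorm_sub (by norm_num)
    (fun n => (φ n).memLp_eval _ 2) (hX.1.sub hY.1) h1
  have h4 := tendsto_eLpNorm_of_tendsto_eLpNorm_sub (by norm_num)
    (fun n => hW.memLp_integral (φ n)) (hX.2.1.sub hY.2.1) h2
  simp only [hW.eLpNorm_integral] at h4
  exact tendsto_nhds_unique h4 h3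

/-- Higher moments of differences of Wiener integrals are controlled by their variance. -/
theorem IsWienerIntegral.eLpNorm_sub_le [IsProbabilityMeasure P] (hT : 0 ≤ T)
    (hW : IsWienerProcess W P) (hX : IsWienerIntegral W P f X) (hY : IsWienerIntegral W P g Y)
    {p : ℝ≥0∞} (hp : p ≠ ∞) :
    eLpNorm (fun ω => X ω - Y ω) p P ≤
      eLpNorm id p (gaussianReal 0 1) * eLpNorm (fun ω => X ω - Y ω) 2 P := by
  obtain ⟨φ, -, h2⟩ := hX.exists_tendsto_sub hW hY
  have hm : MemLp (fun ω => X ω - Y ω) 2 P := hX.2.1.sub hY.2.1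
  have h4 := tendsto_eLpNorm_of_tendsto_eLpNorm_sub (by norm_num)
    (fun n => hW.memLp_integral (φ n)) hm h2
  obtain ⟨ns, hns, hae⟩ := (tendstoInMeasure_of_tendsto_eLpNorm (by norm_num)
    (fun n => (hW.memLp_integral (φ n)).1) hm.1 h2).exists_seq_tendsto_ae
  -- Fatou along an almost surely convergent subsequence carries the Gaussian moment bound to the
  -- limit, so Gaussianity of the limit itself need not be established.
  refine (Lp.eLpNorm_lim_le_liminf_eLpNorm
    (fun n => (hW.memLp_integral (φ (ns n))).1) _ hae).trans ?_
  have h5 : Tendsto (fun n => eLpNorm id p (gaussianReal 0 1) *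
      eLpNorm ((φ (ns n)).integral W) 2 P) atTop
      (𝓝 (eLpNorm id p (gaussianReal 0 1) * eLpNorm (fun ω => X ω - Y ω) 2 P)) :=
    ENNReal.Tendsto.const_mul (h4.comp hns.tendsto_atTop)
      (Or.inr (memLp_id_gaussianReal' p hp).2.ne)
  rw [← h5.liminf_eq]
  refine liminf_le_liminf (Eventually.of_forall fun n => ?_)
  exact (hW.hasGaussianLaw_integral hT _).eLpNorm_le (hW.integral_integral_eq_zero _) p

end WienerIntegral

/-! ### Deterministic dyadic chaining -/

section Dyadic

variable {T : ℝ}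

/-- The dyadic point `k T / 2 ^ n` of `[0, T]`. -/
noncomputable def dyadicPoint (hT : 0 < T) (n k : ℕ) : Icc (0 : ℝ) T :=
  projIcc 0 T hT.le (k / 2 ^ n * T)

/-- The index of the last dyadic point of level `n` before `t`. -/
noncomputable def dyadicIndex (n : ℕ) (t : Icc (0 : ℝ) T) : ℕ := ⌊(t : ℝ) / T * 2 ^ n⌋₊

theorem coe_dyadicPoint (hT : 0 < T) {n k : ℕ} (hk : k ≤ 2 ^ n) :
    (dyadicPoint hT n k : ℝ) = k / 2 ^ n * T := by
  have hk' : (k : ℝ) / 2 ^ n ≤ 1 := by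
    rw [div_le_one (by positivity)]
    exact_mod_cast hk
  unfold dyadicPoint
  rw [projIcc_of_mem hT.le ⟨by positivity, mul_le_of_le_one_left hT.le hk'⟩]

theorem dyadicPoint_succ_two_mul (hT : 0 < T) (n k : ℕ) :
    dyadicPoint hT (n + 1) (2 * k) = dyadicPoint hT n k := by
  unfold dyadicPoint
  congr 2
  push_cast
  rw [pow_succ']
  field_simp

theorem dyadicIndex_le (hT : 0 < T) (n : ℕ) (t : Icc (0 : ℝ) T) : dyadicIndex n t ≤ 2 ^ n := by
  refine Nat.floor_le_of_le ?_
  push_cast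
  exact mul_le_of_le_one_left (by positivity) ((div_le_one hT).2 t.2.2)

theorem dyadicIndex_mono (hT : 0 < T) (n : ℕ) {s t : Icc (0 : ℝ) T} (h : s ≤ t) :
    dyadicIndex n s ≤ dyadicIndex n t := by
  have : (s : ℝ) ≤ t := h
  unfold dyadicIndex
  gcongr

theorem dyadicIndex_le_add_one (hT : 0 < T) {n : ℕ} {s t : Icc (0 : ℝ) T}
    (h : (t : ℝ) - s ≤ T / 2 ^ n) : dyadicIndex n t ≤ dyadicIndex n s + 1 := by
  unfold dyadicIndex
  have hs : 0 ≤ (s : ℝ) / T * 2 ^ n := mul_nonneg (div_nonneg s.2.1 hT.le) (by positivity)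
  rw [← Nat.floor_add_one hs]
  refine Nat.floor_le_floor ?_
  have h2 : (t : ℝ) ≤ s + T / 2 ^ n := by linarith
  calc (t : ℝ) / T * 2 ^ n ≤ (s + T / 2 ^ n) / T * 2 ^ n := by gcongr
    _ = _ := by field_simp

theorem dyadicIndex_succ (hT : 0 < T) (n : ℕ) (t : Icc (0 : ℝ) T) :
    dyadicIndex (n + 1) t = 2 * dyadicIndex n t ∨
      dyadicIndex (n + 1) t = 2 * dyadicIndex n t + 1 := by
  unfold dyadicIndex
  have ht : 0 ≤ (t : ℝ) / T * 2 ^ n := mul_nonneg (div_nonneg t.2.1 hT.le) (by positivity)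
  have e : (t : ℝ) / T * 2 ^ (n + 1) = 2 * (t / T * 2 ^ n) := by ring
  rw [e]
  generalize (t : ℝ) / T * 2 ^ n = x at ht
  have h1 := Nat.floor_le ht
  have h2 := Nat.lt_floor_add_one x
  have h3 : 2 * ⌊x⌋₊ ≤ ⌊2 * x⌋₊ := Nat.le_floor (by push_cast; linarith)
  have h4 : ⌊2 * x⌋₊ < 2 * ⌊x⌋₊ + 2 := (Nat.floor_lt (by linarith)).2 (by push_cast; linarith)
  omega

theorem dyadicPoint_dyadicIndex_le (hT : 0 < T) (n : ℕ) (t : Icc (0 : ℝ) T) :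
    dyadicPoint hT n (dyadicIndex n t) ≤ t := by
  refine Subtype.coe_le_coe.1 ?_
  rw [coe_dyadicPoint hT (dyadicIndex_le hT n t)]
  have ht : 0 ≤ (t : ℝ) / T * 2 ^ n := mul_nonneg (div_nonneg t.2.1 hT.le) (by positivity)
  have h := Nat.floor_le ht
  rw [← le_div_iff₀ hT, div_le_iff₀ (by positivity)]
  exact h

theorem sub_dyadicPoint_dyadicIndex_le (hT : 0 < T) (n : ℕ) (t : Icc (0 : ℝ) T) :
    (t : ℝ) - dyadicPoint hT n (dyadicIndex n t) ≤ T / 2 ^ n := by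
  rw [coe_dyadicPoint hT (dyadicIndex_le hT n t)]
  have h := (Nat.lt_floor_add_one ((t : ℝ) / T * 2 ^ n)).le
  rw [← le_div_iff₀ (by positivity), div_le_iff₀ hT] at h
  refine (sub_le_sub_right h _).trans_eq ?_
  unfold dyadicIndex
  ring

variable {y z : Icc (0 : ℝ) T → ℝ} {A r : ℝ}

/-- The approximations of `t` from below at levels `n` and `n + 1` either coincide or are neighbours
at level `n + 1`, so one dyadic increment bounds the change. -/
theorem dist_dyadicPoint_succ_le (hT : 0 < T) (hA : 0 ≤ A) (hr : 0 ≤ r)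
    (h : ∀ n, ∀ k < 2 ^ n, |y (dyadicPoint hT n (k + 1)) - y (dyadicPoint hT n k)| ≤ A * r ^ n)
    (t : Icc (0 : ℝ) T) (n : ℕ) :
    dist (y (dyadicPoint hT n (dyadicIndex n t)))
      (y (dyadicPoint hT (n + 1) (dyadicIndex (n + 1) t))) ≤ A * r * r ^ n := by
  have hle := dyadicIndex_le hT (n + 1) t
  rw [mul_assoc, ← pow_succ']
  rcases dyadicIndex_succ hT n t with h1 | h1
  · rw [h1, dyadicPoint_succ_two_mul, dist_self]
    positivity
  · rw [h1] at hle
    rw [h1, ← dyadicPoint_succ_two_mul, dist_comm]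
    exact h (n + 1) _ hle

theorem tendsto_limUnder_dyadicPoint (hT : 0 < T) (hA : 0 ≤ A) (hr : 0 ≤ r) (hr1 : r < 1)
    (h : ∀ n, ∀ k < 2 ^ n, |y (dyadicPoint hT n (k + 1)) - y (dyadicPoint hT n k)| ≤ A * r ^ n)
    (t : Icc (0 : ℝ) T) :
    Tendsto (fun n => y (dyadicPoint hT n (dyadicIndex n t))) atTop
      (𝓝 (limUnder atTop fun n => y (dyadicPoint hT n (dyadicIndex n t)))) :=
  (cauchySeq_of_le_geometric r (A * r) hr1 (dist_dyadicPoint_succ_le hT hA hr h t)).tendsto_limUnder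

/-- At level `n` the approximations of `s` and `t` are equal or adjacent, costing at most `A * r ^
n`. Each of the two geometric tails from level `n` to the limit costs `A * r / (1 - r) * r ^ n`. -/
theorem abs_sub_le_of_dyadic (hT : 0 < T) (hA : 0 ≤ A) (hr : 0 ≤ r) (hr1 : r < 1)
    (h : ∀ n, ∀ k < 2 ^ n, |y (dyadicPoint hT n (k + 1)) - y (dyadicPoint hT n k)| ≤ A * r ^ n)
    (hz : ∀ t, Tendsto (fun n => y (dyadicPoint hT n (dyadicIndex n t))) atTop (𝓝 (z t)))
    {n : ℕ} {s t : Icc (0 : ℝ) T} (hst : s ≤ t) (hts : (t : ℝ) - s ≤ T / 2 ^ n) :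
    |z t - z s| ≤ (A + 2 * (A * r / (1 - r))) * r ^ n := by
  have hd (t) : dist (y (dyadicPoint hT n (dyadicIndex n t))) (z t) ≤ A * r * r ^ n / (1 - r) :=
    dist_le_of_le_geometric_of_tendsto r (A * r) hr1 (dist_dyadicPoint_succ_le hT hA hr h t)
      (hz t) n
  have hm : |y (dyadicPoint hT n (dyadicIndex n t)) - y (dyadicPoint hT n (dyadicIndex n s))| ≤
      A * r ^ n := by
    have h1 := dyadicIndex_mono hT n hst
    have h2 := dyadicIndex_le_add_one hT hts
    have h3 := dyadicIndex_le hT n t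
    rcases h1.eq_or_lt with h1 | h1
    · rw [h1, sub_self, abs_zero]
      positivity
    · have h4 : dyadicIndex n t = dyadicIndex n s + 1 := by omega
      rw [h4]
      exact h n _ (by omega)
  have h1 := hd t
  have h2 := hd s
  rw [Real.dist_eq] at h1 h2
  have e : (A + 2 * (A * r / (1 - r))) * r ^ n = A * r ^ n + 2 * (A * r * r ^ n / (1 - r)) := by
    ring
  rw [e]
  rw [abs_le] at *
  constructor <;> linarith [h1.1, h1.2, h2.1, h2.2, hm.1, hm.2]

theorem exists_holderWith_of_dyadic (hT : 0 < T) (hA : 0 ≤ A) {δ : ℝ≥0} (hδ : 0 < δ)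
    (h : ∀ n, ∀ k < 2 ^ n, |y (dyadicPoint hT n (k + 1)) - y (dyadicPoint hT n k)| ≤
      A * ((2 : ℝ) ^ (-(δ : ℝ))) ^ n)
    (hz : ∀ t, Tendsto (fun n => y (dyadicPoint hT n (dyadicIndex n t))) atTop (𝓝 (z t))) :
    ∃ L : ℝ≥0, HolderWith L δ z := by
  set r : ℝ := (2 : ℝ) ^ (-(δ : ℝ)) with hr_def
  have hr : 0 < r := by positivity
  have hr1 : r < 1 := Real.rpow_lt_one_of_one_lt_of_neg (by norm_num) (by simpa using hδ)
  set B : ℝ := A + 2 * (A * r / (1 - r)) with hB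
  have hB0 : 0 ≤ B := by
    have : 0 < 1 - r := by linarith
    positivity
  have key {s t : Icc (0 : ℝ) T} (hst : s < t) :
      |z t - z s| ≤ B * r⁻¹ * (T⁻¹) ^ (δ : ℝ) * ((t : ℝ) - s) ^ (δ : ℝ) := by
    have hpos : 0 < (t : ℝ) - s := sub_pos.2 hst
    have hle : ((t : ℝ) - s) / T ≤ 1 := by
      rw [div_le_one hT]; linarith [t.2.2, s.2.1]
    -- The scale satisfies `2⁻¹ ^ (n + 1) < (t - s) / T ≤ 2⁻¹ ^ n`. The upper bound permits chaining
    -- from level `n`; the lower bound converts `r ^ (n + 1)` into a power of `t - s`, and the lost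
    -- level is the factor `r⁻¹`.
    obtain ⟨n, h1, h2⟩ := exists_nat_pow_near_of_lt_one (div_pos hpos hT) hle
      (y := (2⁻¹ : ℝ)) (by norm_num) (by norm_num)
    have h3 : (t : ℝ) - s ≤ T / 2 ^ n := by
      rw [div_le_iff₀ hT] at h2
      rw [inv_pow] at h2
      exact h2.trans_eq (by field_simp)
    refine (abs_sub_le_of_dyadic hT hA hr.le hr1 h hz hst.le h3).trans ?_
    rw [mul_assoc, mul_assoc]
    refine mul_le_mul_of_nonneg_left ?_ hB0
    rw [← Real.mul_rpow (by positivity) hpos.le, ← div_eq_inv_mul _ T]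
    have h4 : r ^ (n + 1) = ((2⁻¹ : ℝ) ^ (n + 1)) ^ (δ : ℝ) := by
      rw [hr_def, ← Real.rpow_natCast, ← Real.rpow_natCast, ← Real.rpow_mul (by norm_num),
        ← Real.rpow_mul (by norm_num), Real.inv_rpow (by norm_num), ← Real.rpow_neg (by norm_num)]
      congr 1; ring
    have h5 : r ^ n = r⁻¹ * r ^ (n + 1) := by
      rw [pow_succ']; field_simp
    rw [h5, h4]
    gcongr
  refine ⟨(B * r⁻¹ * (T⁻¹) ^ (δ : ℝ)).toNNReal, fun t s => ?_⟩
  have hC : 0 ≤ B * r⁻¹ * (T⁻¹) ^ (δ : ℝ) := by positivity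
  have key2 : dist (z t) (z s) ≤ B * r⁻¹ * (T⁻¹) ^ (δ : ℝ) * dist t s ^ (δ : ℝ) := by
    rcases lt_trichotomy t s with h | rfl | h
    · have := key h
      rwa [dist_comm, dist_comm t s, Real.dist_eq, Subtype.dist_eq, Real.dist_eq,
        abs_of_pos (sub_pos.2 (Subtype.coe_lt_coe.2 h))]
    · simp only [dist_self]
      positivity
    · have := key h
      rwa [Real.dist_eq, Subtype.dist_eq, Real.dist_eq,
        abs_of_pos (sub_pos.2 (Subtype.coe_lt_coe.2 h))]
  rw [edist_dist, edist_dist, ENNReal.ofReal_rpow_of_nonneg dist_nonneg (by positivity)]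
  rw [← ENNReal.ofReal_coe_nnreal, Real.coe_toNNReal _ hC, ← ENNReal.ofReal_mul hC]
  exact ENNReal.ofReal_le_ofReal key2

end Dyadic

/-! ### Continuity theorem from moments of all orders -/

section Kolmogorov

variable {Ω : Type*} [MeasurableSpace Ω] {P : Measure Ω} {T : ℝ}

/-- If all moments of an array with `2 ^ n` variables in row `n` decay like `w ^ n`, then almost
surely the entries are `O(r ^ n)` for every `r > w`. -/
theorem ae_exists_abs_le_mul_pow {D : ℕ → ℕ → Ω → ℝ} {w r : ℝ} (hw : 0 < w) (hwr : w < r)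
    (hD : ∀ n k, AEStronglyMeasurable (D n k) P)
    (hm : ∀ q : ℕ, ∃ C : ℝ, 0 ≤ C ∧
      ∀ n, ∀ k < 2 ^ n, eLpNorm (D n k) q P ≤ ENNReal.ofReal (C * w ^ n)) :
    ∀ᵐ ω ∂P, ∃ A : ℝ, 0 ≤ A ∧ ∀ n, ∀ k < 2 ^ n, |D n k ω| ≤ A * r ^ n := by
  have hr : 0 < r := hw.trans hwr
  -- With `(w / r) ^ q < 1 / 4`, summing the `2 ^ n` entries of row `n` still leaves a contribution
  -- of order `(1 / 2) ^ n`.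
  obtain ⟨q, hq⟩ := exists_pow_lt_of_lt_one (show (0 : ℝ) < 1 / 4 by norm_num)
    ((div_lt_one hr).2 hwr)
  have hq0 : q ≠ 0 := by rintro rfl; norm_num at hq
  obtain ⟨C, hC, hCm⟩ := hm q
  -- A single random sum dominates every normalized entry. Its expectation is finite, so almost
  -- surely `S ^ (1 / q)` is a finite uniform constant; this replaces Borel–Cantelli.
  let S : Ω → ℝ≥0∞ := fun ω => ∑' n, ∑ k ∈ Finset.range (2 ^ n),
    (‖D n k ω‖ₑ * ENNReal.ofReal (r⁻¹ ^ n)) ^ q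
  have hmeas (n k : ℕ) :
      AEMeasurable (fun ω => (‖D n k ω‖ₑ * ENNReal.ofReal (r⁻¹ ^ n)) ^ q) P :=
    (((hD n k).enorm).mul_const _).pow_const _
  have hmeas2 (n : ℕ) : AEMeasurable (fun ω => ∑ k ∈ Finset.range (2 ^ n),
      (‖D n k ω‖ₑ * ENNReal.ofReal (r⁻¹ ^ n)) ^ q) P :=
    Finset.aemeasurable_fun_sum _ fun k _ => hmeas n k
  have hterm (n k : ℕ) (hk : k < 2 ^ n) :
      ∫⁻ ω, (‖D n k ω‖ₑ * ENNReal.ofReal (r⁻¹ ^ n)) ^ q ∂P ≤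
        ENNReal.ofReal (C ^ q * ((w / r) ^ q) ^ n) := by
    have h1 := eLpNorm_nnreal_pow_eq_lintegral (f := D n k) (p := (q : ℝ≥0)) (μ := P)
      (by exact_mod_cast hq0)
    simp only [NNReal.coe_natCast, ENNReal.rpow_natCast, ENNReal.coe_natCast] at h1
    simp only [mul_pow]
    rw [lintegral_mul_const' _ _ (by simp), ← h1]
    calc eLpNorm (D n k) q P ^ q * ENNReal.ofReal (r⁻¹ ^ n) ^ q
        ≤ ENNReal.ofReal (C * w ^ n) ^ q * ENNReal.ofReal (r⁻¹ ^ n) ^ q := by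
          gcongr
          exact hCm n k hk
      _ = _ := by
          rw [← ENNReal.ofReal_pow (by positivity), ← ENNReal.ofReal_pow (by positivity),
            ← ENNReal.ofReal_mul (by positivity)]
          congr 1
          rw [← mul_pow, ← pow_mul, mul_comm q n, pow_mul, ← mul_pow, mul_assoc, ← mul_pow,
            div_eq_mul_inv]
  have hS : ∫⁻ ω, S ω ∂P < ∞ := by
    rw [lintegral_tsum hmeas2]
    calc ∑' n, ∫⁻ ω, ∑ k ∈ Finset.range (2 ^ n), (‖D n k ω‖ₑ * ENNReal.ofReal (r⁻¹ ^ n)) ^ q ∂P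
        ≤ ∑' n : ℕ, ENNReal.ofReal (C ^ q * (1 / 2) ^ n) := by
          refine ENNReal.tsum_le_tsum fun n => ?_
          rw [lintegral_finsetSum' _ fun k _ => hmeas n k]
          refine (Finset.sum_le_card_nsmul _ _ _ fun k hk =>
            hterm n k (Finset.mem_range.1 hk)).trans ?_
          rw [Finset.card_range, nsmul_eq_mul, ← ENNReal.ofReal_natCast,
            ← ENNReal.ofReal_mul (by positivity)]
          refine ENNReal.ofReal_le_ofReal ?_
          push_cast
          rw [mul_left_comm, ← mul_pow]
          gcongr
          linarith
      _ = ENNReal.ofReal (∑' n : ℕ, C ^ q * (1 / 2) ^ n) :=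
          (ENNReal.ofReal_tsum_of_nonneg (fun n => by positivity)
            (summable_geometric_two.mul_left _)).symm
      _ < ∞ := ENNReal.ofReal_lt_top
  filter_upwards [ae_lt_top' (AEMeasurable.tsum hmeas2) hS.ne] with ω hω
  refine ⟨((S ω) ^ (1 / q : ℝ)).toReal, ENNReal.toReal_nonneg, fun n k hk => ?_⟩
  have h1 : (‖D n k ω‖ₑ * ENNReal.ofReal (r⁻¹ ^ n)) ^ q ≤ S ω :=
    (Finset.single_le_sum (f := fun k => (‖D n k ω‖ₑ * ENNReal.ofReal (r⁻¹ ^ n)) ^ q)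
      (fun _ _ => zero_le) (Finset.mem_range.2 hk)).trans
      (ENNReal.le_tsum (f := fun n => ∑ k ∈ Finset.range (2 ^ n),
        (‖D n k ω‖ₑ * ENNReal.ofReal (r⁻¹ ^ n)) ^ q) n)
  have h2 : ‖D n k ω‖ₑ * ENNReal.ofReal (r⁻¹ ^ n) ≤ (S ω) ^ (1 / q : ℝ) := by
    rw [one_div, ENNReal.le_rpow_inv_iff (by positivity), ENNReal.rpow_natCast]
    exact h1
  have h3 := ENNReal.toReal_mono (ENNReal.rpow_ne_top_of_nonneg (by positivity) hω.ne) h2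
  rw [ENNReal.toReal_mul, toReal_enorm, ENNReal.toReal_ofReal (by positivity), Real.norm_eq_abs,
    inv_pow, ← div_eq_mul_inv, div_le_iff₀ (by positivity)] at h3
  exact h3

/-- A version of the Kolmogorov continuity theorem: if all moments of the increments of a process
are controlled by the same power `β` of the time increment, the process has a modification whose
paths are Hölder continuous of every order less than `β`. -/
theorem exists_modification_holderWith (hT : 0 < T) {β : ℝ} (hβ : 0 < β)
    {Y : Icc (0 : ℝ) T → Ω → ℝ} (hY : ∀ t, AEStronglyMeasurable (Y t) P)
    (hm : ∀ q : ℕ, ∃ C : ℝ, 0 ≤ C ∧ ∀ s t : Icc (0 : ℝ) T, s ≤ t →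
      eLpNorm (fun ω => Y t ω - Y s ω) q P ≤ ENNReal.ofReal (C * ((t : ℝ) - s) ^ β)) :
    ∃ Y' : Icc (0 : ℝ) T → Ω → ℝ, (∀ t, Y' t =ᵐ[P] Y t) ∧
      ∀ᵐ ω ∂P, ∀ δ : ℝ≥0, 0 < δ → (δ : ℝ) < β → ∃ L : ℝ≥0, HolderWith L δ (fun t => Y' t ω) := by
  set w : ℝ := (2 : ℝ) ^ (-β) with hw_def
  have hw : 0 < w := by positivity
  have hw1 : w < 1 := Real.rpow_lt_one_of_one_lt_of_neg (by norm_num) (by simpa using hβ)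
  let D : ℕ → ℕ → Ω → ℝ := fun n k ω =>
    Y (dyadicPoint hT n (k + 1)) ω - Y (dyadicPoint hT n k) ω
  have hpow (n : ℕ) : (T / 2 ^ n) ^ β = T ^ β * w ^ n := by
    rw [Real.div_rpow hT.le (by positivity), hw_def, ← Real.rpow_natCast, ← Real.rpow_natCast,
      ← Real.rpow_mul (by norm_num), ← Real.rpow_mul (by norm_num), div_eq_mul_inv,
      ← Real.rpow_neg (by norm_num)]
    congr 2; ring
  have hDm (q : ℕ) : ∃ C : ℝ, 0 ≤ C ∧
      ∀ n, ∀ k < 2 ^ n, eLpNorm (D n k) q P ≤ ENNReal.ofReal (C * w ^ n) := by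
    obtain ⟨C, hC, h⟩ := hm q
    refine ⟨C * T ^ β, by positivity, fun n k hk => ?_⟩
    have e : (dyadicPoint hT n (k + 1) : ℝ) - dyadicPoint hT n k = T / 2 ^ n := by
      rw [coe_dyadicPoint hT hk, coe_dyadicPoint hT hk.le]
      push_cast
      ring
    have hle : dyadicPoint hT n k ≤ dyadicPoint hT n (k + 1) := by
      refine Subtype.coe_le_coe.1 (sub_nonneg.1 ?_)
      rw [e]; positivity
    refine (h _ _ hle).trans_eq ?_
    rw [e, hpow, mul_assoc]
  -- Restricting to rational rates makes the exceptional sets countable in number, so one null set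
  -- serves all exponents `δ < β`: some rational lies between `2 ^ (-β)` and `2 ^ (-δ)`.
  have hae : ∀ᵐ ω ∂P, ∀ ρ : ℚ, w < ρ →
      ∃ A : ℝ, 0 ≤ A ∧ ∀ n, ∀ k < 2 ^ n, |D n k ω| ≤ A * (ρ : ℝ) ^ n := by
    refine ae_all_iff.2 fun ρ => ?_
    by_cases hρ : w < ρ
    · filter_upwards [ae_exists_abs_le_mul_pow hw hρ (fun n k => (hY _).sub (hY _)) hDm]
        with ω h _ using h
    · exact Eventually.of_forall fun ω h => absurd h hρ
  have hlim : ∀ᵐ ω ∂P, ∀ t : Icc (0 : ℝ) T,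
      Tendsto (fun n => Y (dyadicPoint hT n (dyadicIndex n t)) ω) atTop
        (𝓝 (limUnder atTop fun n => Y (dyadicPoint hT n (dyadicIndex n t)) ω)) := by
    obtain ⟨ρ, h1, h2⟩ := exists_rat_btwn hw1
    filter_upwards [hae] with ω hω t
    obtain ⟨A, hA, h⟩ := hω ρ h1
    exact tendsto_limUnder_dyadicPoint (y := fun t => Y t ω) hT hA (hw.trans h1).le h2 h t
  -- The modification is the pathwise limit along dyadic approximations. It agrees almost surely
  -- with `Y t` because these approximations converge to `Y t` in `L¹`, hence almost surely along a
  -- subsequence.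
  refine ⟨fun t ω => limUnder atTop fun n => Y (dyadicPoint hT n (dyadicIndex n t)) ω,
    fun t => ?_, ?_⟩
  · obtain ⟨C, hC, h⟩ := hm 1
    have h0 : Tendsto (fun n => eLpNorm
        (Y (dyadicPoint hT n (dyadicIndex n t)) - Y t) 1 P) atTop (𝓝 0) := by
      have h1 : Tendsto (fun n => ENNReal.ofReal (C * (T ^ β * w ^ n))) atTop (𝓝 0) := by
        have := ((tendsto_pow_atTop_nhds_zero_of_lt_one hw.le hw1).const_mul (T ^ β)).const_mul C
        simpa using ENNReal.tendsto_ofReal this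
      refine tendsto_of_tendsto_of_tendsto_of_le_of_le tendsto_const_nhds h1
        (fun _ => zero_le) fun n => ?_
      have hle := dyadicPoint_dyadicIndex_le hT n t
      have h2 := h _ _ hle
      rw [Nat.cast_one] at h2
      rw [eLpNorm_sub_comm]
      refine h2.trans (ENNReal.ofReal_le_ofReal ?_)
      rw [← hpow]
      have h3 := sub_dyadicPoint_dyadicIndex_le hT n t
      have h4 : 0 ≤ (t : ℝ) - dyadicPoint hT n (dyadicIndex n t) := sub_nonneg.2 hle
      gcongr
    obtain ⟨ns, hns, hae'⟩ := (tendstoInMeasure_of_tendsto_eLpNorm one_ne_zero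
      (fun n => hY _) (hY t) h0).exists_seq_tendsto_ae
    filter_upwards [hae', hlim] with ω h1 h2
    exact tendsto_nhds_unique ((h2 t).comp hns.tendsto_atTop) h1
  · filter_upwards [hae, hlim] with ω hω hl δ hδ hδβ
    have hlt : w < (2 : ℝ) ^ (-(δ : ℝ)) :=
      Real.rpow_lt_rpow_of_exponent_lt (by norm_num) (by linarith)
    obtain ⟨ρ, h1, h2⟩ := exists_rat_btwn hlt
    obtain ⟨A, hA, h⟩ := hω ρ h1
    refine exists_holderWith_of_dyadic (y := fun t => Y t ω) hT hA hδ (fun n k hk => ?_) hl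
    refine (h n k hk).trans ?_
    have := (hw.trans h1).le
    gcongr

end Kolmogorov

/-! ### Minkowski's integral inequality -/

theorem enorm_le_enorm_of_abs_le {x y : ℝ} (h : |x| ≤ |y|) : ‖x‖ₑ ≤ ‖y‖ₑ := by
  rw [← ofReal_norm, ← ofReal_norm]
  exact ENNReal.ofReal_le_ofReal h

theorem lintegral_mul_le_eLpNorm_two {α : Type*} [MeasurableSpace α] {μ : Measure α}
    {f g : α → ℝ≥0∞} (hf : AEMeasurable f μ) (hg : AEMeasurable g μ) :
    ∫⁻ x, f x * g x ∂μ ≤ eLpNorm f 2 μ * eLpNorm g 2 μ := by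
  refine (ENNReal.lintegral_mul_le_Lp_mul_Lq μ Real.HolderConjugate.two_two hf hg).trans_eq ?_
  rw [eLpNorm_eq_lintegral_rpow_enorm_toReal (by norm_num) (by norm_num),
    eLpNorm_eq_lintegral_rpow_enorm_toReal (by norm_num) (by norm_num)]
  simp

/-- Minkowski's integral inequality in `L²`. -/
theorem eLpNorm_two_lintegral_le {α β : Type*} [MeasurableSpace α] [MeasurableSpace β]
    {μ : Measure α} {ν : Measure β} [SFinite μ] [SFinite ν] {F : β → α → ℝ≥0∞}
    (hF : Measurable (Function.uncurry F)) {N : β → ℝ≥0∞} (hN : Measurable N)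
    (h : ∀ᵐ u ∂ν, eLpNorm (F u) 2 μ ≤ N u) :
    eLpNorm (fun s => ∫⁻ u, F u s ∂ν) 2 μ ≤ ∫⁻ u, N u ∂ν := by
  have hFu (u) : Measurable (F u) := hF.comp measurable_prodMk_left
  have hFs (s) : Measurable fun u => F u s := hF.comp measurable_prodMk_right
  -- The squared inner integral is an integral over pairs; after Tonelli, Cauchy–Schwarz in `s` is
  -- applied to each pair and the bound factorizes again.
  have key : ∫⁻ s, (∫⁻ u, F u s ∂ν) ^ 2 ∂μ ≤ (∫⁻ u, N u ∂ν) ^ 2 := by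
    calc ∫⁻ s, (∫⁻ u, F u s ∂ν) ^ 2 ∂μ
        = ∫⁻ s, ∫⁻ p, F p.1 s * F p.2 s ∂(ν.prod ν) ∂μ := by
          congr 1; ext s
          rw [sq, lintegral_prod_mul (hFs s).aemeasurable (hFs s).aemeasurable]
      _ = ∫⁻ p, ∫⁻ s, F p.1 s * F p.2 s ∂μ ∂(ν.prod ν) := by
          refine lintegral_lintegral_swap (Measurable.aemeasurable ?_)
          exact (hF.comp (measurable_snd.fst.prodMk measurable_fst)).mul
            (hF.comp (measurable_snd.snd.prodMk measurable_fst))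
      _ ≤ ∫⁻ p, N p.1 * N p.2 ∂(ν.prod ν) := by
          refine lintegral_mono_ae ?_
          filter_upwards [Measure.quasiMeasurePreserving_fst.ae h,
            Measure.quasiMeasurePreserving_snd.ae h] with p h1 h2
          exact (lintegral_mul_le_eLpNorm_two (hFu _).aemeasurable (hFu _).aemeasurable).trans
            (mul_le_mul' h1 h2)
      _ = (∫⁻ u, N u ∂ν) ^ 2 := by
          rw [sq, lintegral_prod_mul hN.aemeasurable hN.aemeasurable]
  rw [eLpNorm_eq_lintegral_rpow_enorm_toReal (by norm_num) (by norm_num)]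
  simp only [ENNReal.toReal_ofNat, enorm_eq_self, ENNReal.rpow_ofNat, one_div]
  rw [ENNReal.rpow_inv_le_iff (by norm_num)]
  simpa using key

theorem lintegral_rpow_sub {x t r : ℝ} (hxt : x ≤ t) (hr : -1 < r) :
    ∫⁻ u in Ioc x t, ENNReal.ofReal ((u - x) ^ r) =
      ENNReal.ofReal ((t - x) ^ (r + 1) / (r + 1)) := by
  have hi : IntervalIntegrable (fun u : ℝ => (u - x) ^ r) volume x t := by
    have := (intervalIntegral.intervalIntegrable_rpow' (a := 0) (b := t - x) hr).comp_sub_right x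
    simpa using this
  rw [← ofReal_integral_eq_lintegral_ofReal
    ((intervalIntegrable_iff_integrableOn_Ioc_of_le hxt).1 hi),
    ← intervalIntegral.integral_of_le hxt,
    intervalIntegral.integral_comp_sub_right (fun u => u ^ r), sub_self, integral_rpow (Or.inl hr),
    Real.zero_rpow (by linarith), sub_zero]
  filter_upwards [ae_restrict_mem measurableSet_Ioc] with u hu
  exact Real.rpow_nonneg (by linarith [hu.1]) _

/-! ### `L²` estimates of the kernel -/

theorem measurable_sonineKernel {a b c : ℝ → ℝ} (ha : Measurable a) (hc : Measurable c) (t : ℝ) :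
    Measurable (sonineKernel a b c t) := by
  have hg : Measurable fun p : ℝ × ℝ => deriv b p.2 * c (p.2 - p.1) :=
    ((measurable_deriv b).comp measurable_snd).mul (hc.comp (measurable_snd.sub measurable_fst))
  have h1 : Measurable fun s => ∫ u in Ioc s t, deriv b u * c (u - s) := by
    have hS : MeasurableSet {p : ℝ × ℝ | p.1 < p.2 ∧ p.2 ≤ t} :=
      (measurableSet_lt measurable_fst measurable_snd).inter
        (measurableSet_le measurable_snd measurable_const)
    have := (hg.indicator hS).stronglyMeasurable.integral_prod_right' (ν := volume)
    convert this.measurable using 1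
    ext s
    rw [← integral_indicator measurableSet_Ioc]
    congr 1
  have h2 : Measurable fun s => ∫ u in Ioc t s, deriv b u * c (u - s) := by
    have hS : MeasurableSet {p : ℝ × ℝ | t < p.2 ∧ p.2 ≤ p.1} :=
      (measurableSet_lt measurable_const measurable_snd).inter
        (measurableSet_le measurable_snd measurable_fst)
    have := (hg.indicator hS).stronglyMeasurable.integral_prod_right' (ν := volume)
    convert this.measurable using 1
    ext s
    rw [← integral_indicator measurableSet_Ioc]
    congr 1
  have h3 : Measurable fun s => c (t - s) := hc.comp (measurable_const.sub measurable_id)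
  exact ha.mul ((h3.const_mul (b t)).sub (h1.sub h2))

/-- The quantitative properties of `a`, `b`, `c` that control the kernel. -/
structure SonineKernelBounds (T β M C κ : ℝ) (a b c : ℝ → ℝ) : Prop where
  measurable_a : Measurable a
  measurable_c : Measurable c
  exponent_pos : 0 < β
  exponent_le_one : β ≤ 1
  M_nonneg : 0 ≤ M
  C_nonneg : 0 ≤ C
  κ_nonneg : 0 ≤ κ
  a_pos : ∀ s ∈ Ioc 0 T, 0 < a s
  a_mono : MonotoneOn a (Ioc 0 T)
  abs_mul_le : ∀ t ∈ Ioc 0 T, |a t * b t| ≤ M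
  abs_mul_deriv_le : ∀ᵐ u ∂volume.restrict (Ioc 0 T), |a u * deriv b u| ≤ C * u⁻¹
  eLpNorm_c_le : ∀ u x, 0 ≤ x → x ≤ u → u ≤ T →
    eLpNorm (fun s => c (u - s)) 2 (volume.restrict (Ioc x u)) ≤ ENNReal.ofReal (κ * (u - x) ^ β)
  eLpNorm_c_sub_le : ∀ u v, 0 ≤ u → u ≤ v → v ≤ T →
    eLpNorm (fun s => c (v - s) - c (u - s)) 2 (volume.restrict (Ioc 0 u)) ≤
      ENNReal.ofReal (κ * (v - u) ^ β)
  intervalIntegrable_deriv : ∀ x t, 0 < x → x ≤ t → t ≤ T →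
    IntervalIntegrable (deriv b) volume x t
  integral_deriv : ∀ x t, 0 < x → x ≤ t → t ≤ T → ∫ u in x..t, deriv b u = b t - b x

namespace SonineKernelBounds

variable {T β M C κ : ℝ} {a b c : ℝ → ℝ}

/-- Positivity and monotonicity of `a` allow its argument to be moved up to that of `b` or `b'`,
where the bounds on the products are available. -/
theorem enorm_mul_le (h : SonineKernelBounds T β M C κ a b c) {s t : ℝ} (hs : 0 < s) (hst : s ≤ t)
    (ht : t ≤ T) (y : ℝ) : ‖a s * y‖ₑ ≤ ‖a t * y‖ₑ := by
  have h1 := h.a_pos s ⟨hs, hst.trans ht⟩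
  have h2 := h.a_mono ⟨hs, hst.trans ht⟩ ⟨hs.trans_le hst, ht⟩ hst
  rw [enorm_mul, enorm_mul]
  gcongr
  refine enorm_le_enorm_of_abs_le ?_
  rwa [abs_of_pos h1, abs_of_pos (h1.trans_le h2)]

/-- The integrand of the integral part of the kernel, in absolute value. -/
noncomputable def integrand (a b c : ℝ → ℝ) (u s : ℝ) : ℝ≥0∞ :=
  if s < u then ‖a s * deriv b u‖ₑ * ‖c (u - s)‖ₑ else 0

theorem measurable_integrand (ha : Measurable a) (hc : Measurable c) :
    Measurable (Function.uncurry (integrand a b c)) := by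
  have hS : MeasurableSet {p : ℝ × ℝ | p.2 < p.1} := measurableSet_lt measurable_snd measurable_fst
  refine Measurable.ite hS ?_ measurable_const
  exact (((ha.comp measurable_snd).mul ((measurable_deriv b).comp measurable_fst)).enorm).mul
    (hc.comp (measurable_fst.sub measurable_snd)).enorm

/-- By Minkowski it is enough to integrate the norms of the slices. The slice at `u` has norm at
most `C u⁻¹ κ (u - x)^β ≤ C κ (u - x)^(β - 1)`, as `x ≥ 0`; integration over `(x, t]` produces the
factor `1 / β`. -/
theorem eLpNorm_lintegral_integrand_le (h : SonineKernelBounds T β M C κ a b c) {x t : ℝ}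
    (hx : 0 ≤ x) (hxt : x ≤ t) (ht : t ≤ T) :
    eLpNorm (fun s => ∫⁻ u in Ioc x t, integrand a b c u s) 2 (volume.restrict (Ioc x t)) ≤
      ENNReal.ofReal (C * κ / β * (t - x) ^ β) := by
  have hβ := h.exponent_pos
  have hC := h.C_nonneg
  have hκ := h.κ_nonneg
  have hN : Measurable fun u : ℝ => ENNReal.ofReal (C * κ) * ENNReal.ofReal ((u - x) ^ (β - 1)) :=
    by fun_prop
  refine (eLpNorm_two_lintegral_le (measurable_integrand h.measurable_a h.measurable_c) hN
    ?_).trans_eq ?_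
  · have hsub : Ioc x t ⊆ Ioc 0 T := Ioc_subset_Ioc hx ht
    filter_upwards [ae_restrict_of_ae_restrict_of_subset hsub h.abs_mul_deriv_le,
      ae_restrict_mem measurableSet_Ioc] with u hu1 hu
    have hux : 0 < u - x := sub_pos.2 hu.1
    have hu0 : 0 < u := hx.trans_lt hu.1
    have h1 : eLpNorm (integrand a b c u) 2 (volume.restrict (Ioc x t)) ≤
        ENNReal.ofReal (C * u⁻¹) *
          eLpNorm (fun s => c (u - s)) 2 (volume.restrict (Ioc x u)) := by
      have h2 : eLpNorm (integrand a b c u) 2 (volume.restrict (Ioc x t)) ≤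
          eLpNorm ((Ioc x u).indicator fun s => (C * u⁻¹) * c (u - s)) 2
            (volume.restrict (Ioc x t)) := by
        refine eLpNorm_mono_enorm_ae ?_
        filter_upwards [ae_restrict_mem measurableSet_Ioc] with s hs
        unfold integrand
        split_ifs with hsu
        · rw [indicator_of_mem (show s ∈ Ioc x u from ⟨hs.1, hsu.le⟩), enorm_eq_self, enorm_mul (C * u⁻¹)]
          gcongr
          refine (h.enorm_mul_le (hx.trans_lt hs.1) hsu.le (hu.2.trans ht) _).trans ?_
          refine enorm_le_enorm_of_abs_le (hu1.trans (le_abs_self _))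
        · simp
      refine h2.trans ?_
      rw [eLpNorm_indicator_eq_eLpNorm_restrict measurableSet_Ioc,
        Measure.restrict_restrict measurableSet_Ioc,
        inter_eq_left.2 (Ioc_subset_Ioc_right hu.2)]
      refine (eLpNorm_const_smul_le (c := C * u⁻¹) (f := fun s => c (u - s))).trans_eq ?_
      rw [Real.enorm_of_nonneg (by positivity)]
    refine h1.trans ((mul_le_mul_right (h.eLpNorm_c_le u x hx hu.1.le (hu.2.trans ht)) _).trans ?_)
    rw [← ENNReal.ofReal_mul (by positivity), ← ENNReal.ofReal_mul (by positivity)]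
    refine ENNReal.ofReal_le_ofReal ?_
    rw [Real.rpow_sub_one hux.ne', div_eq_mul_inv]
    calc C * u⁻¹ * (κ * (u - x) ^ β) = C * κ * ((u - x) ^ β * u⁻¹) := by ring
      _ ≤ _ := by
        gcongr
        linarith
  · rw [lintegral_const_mul _ (by fun_prop), lintegral_rpow_sub hxt (by linarith),
      ← ENNReal.ofReal_mul (by positivity)]
    congr 1
    rw [sub_add_cancel]
    ring

/-- The kernel is small in `L²` close to the diagonal. -/
theorem eLpNorm_sonineKernel_le (h : SonineKernelBounds T β M C κ a b c) {x t : ℝ}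
    (hx : 0 ≤ x) (hxt : x ≤ t) (ht : t ≤ T) :
    eLpNorm (sonineKernel a b c t) 2 (volume.restrict (Ioc x t)) ≤
      ENNReal.ofReal ((M * κ + C * κ / β) * (t - x) ^ β) := by
  have hβ := h.exponent_pos
  have hC := h.C_nonneg
  have hκ := h.κ_nonneg
  have hM := h.M_nonneg
  have htx : 0 ≤ t - x := sub_nonneg.2 hxt
  have hmc : Measurable fun s => c (t - s) := h.measurable_c.comp (measurable_const.sub measurable_id)
  have hm1 : Measurable fun s => a s * b t * c (t - s) :=
    (h.measurable_a.mul_const _).mul hmc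
  have hmK := measurable_sonineKernel (b := b) h.measurable_a h.measurable_c t
  have e : sonineKernel a b c t = (fun s => a s * b t * c (t - s)) -
      ((fun s => a s * b t * c (t - s)) - sonineKernel a b c t) := by ext; simp
  rw [e]
  refine (eLpNorm_sub_le hm1.aestronglyMeasurable (hm1.sub hmK).aestronglyMeasurable
    (by norm_num)).trans ?_
  rw [add_mul, ENNReal.ofReal_add (by positivity) (by positivity), mul_assoc,
    ENNReal.ofReal_mul hM]
  refine add_le_add ?_ ?_
  · refine le_trans ?_ (mul_le_mul_right (h.eLpNorm_c_le t x hx hxt ht) _)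
    have h2 : eLpNorm (fun s => a s * b t * c (t - s)) 2 (volume.restrict (Ioc x t)) ≤
        eLpNorm (fun s => M * c (t - s)) 2 (volume.restrict (Ioc x t)) := by
      refine eLpNorm_mono_enorm_ae ?_
      filter_upwards [ae_restrict_mem measurableSet_Ioc] with s hs
      have hs0 := hx.trans_lt hs.1
      rw [enorm_mul, enorm_mul M]
      gcongr
      refine (h.enorm_mul_le hs0 hs.2 ht _).trans (enorm_le_enorm_of_abs_le ?_)
      exact (h.abs_mul_le t ⟨hs0.trans_le hs.2, ht⟩).trans (le_abs_self _)
    refine h2.trans ((eLpNorm_const_smul_le (c := M) (f := fun s => c (t - s))).trans_eq ?_)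
    rw [Real.enorm_of_nonneg hM]
  · refine le_trans (eLpNorm_mono_enorm_ae ?_) (h.eLpNorm_lintegral_integrand_le hx hxt ht)
    filter_upwards [ae_restrict_mem measurableSet_Ioc] with s hs
    have e2 : ((fun s => a s * b t * c (t - s)) - sonineKernel a b c t) s =
        a s * ∫ u in Ioc s t, deriv b u * c (u - s) := by
      simp only [Pi.sub_apply, sonineKernel, intervalIntegral.integral_of_le hs.2]
      ring
    rw [e2, enorm_eq_self, enorm_mul]
    refine (mul_le_mul_right (enorm_integral_le_lintegral_enorm _) _).trans ?_
    rw [← lintegral_const_mul' _ _ (by simp)]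
    refine (setLIntegral_mono_ae' measurableSet_Ioc (Eventually.of_forall fun u hu => ?_)).trans
      (lintegral_mono_set (Ioc_subset_Ioc_left hs.1.le))
    simp only [integrand, if_pos hu.1, enorm_mul, mul_assoc, le_refl]

/-- The finite `L²` norm of the integral part makes it finite for almost every `s`, and the factor
`a s > 0` can be divided out. This justifies splitting the integral in the kernel at an intermediate
time. -/
theorem ae_intervalIntegrable (h : SonineKernelBounds T β M C κ a b c) {t : ℝ}
    (ht0 : 0 ≤ t) (ht : t ≤ T) :
    ∀ᵐ s ∂volume.restrict (Ioc 0 t),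
      IntervalIntegrable (fun u => deriv b u * c (u - s)) volume s t := by
  have h1 := (h.eLpNorm_lintegral_integrand_le le_rfl ht0 ht).trans_lt ENNReal.ofReal_lt_top
  have hm : Measurable fun s => ∫⁻ u in Ioc 0 t, integrand a b c u s :=
    (measurable_integrand h.measurable_a h.measurable_c).lintegral_prod_left'
  have h2 := lintegral_rpow_enorm_lt_top_of_eLpNorm_lt_top (by norm_num) (by norm_num) h1
  simp only [enorm_eq_self, ENNReal.toReal_ofNat, ENNReal.rpow_ofNat] at h2
  filter_upwards [ae_lt_top (hm.pow_const 2) h2.ne, ae_restrict_mem measurableSet_Ioc] with s h3 hs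
  rw [intervalIntegrable_iff_integrableOn_Ioc_of_le hs.2]
  have hmeas : Measurable fun u => deriv b u * c (u - s) :=
    (measurable_deriv b).mul (h.measurable_c.comp (measurable_id.sub_const s))
  refine ⟨hmeas.aestronglyMeasurable, ?_⟩
  have h4 : (∫⁻ u in Ioc 0 t, integrand a b c u s) < ∞ := by
    by_contra h5
    rw [not_lt, top_le_iff] at h5
    simp [h5] at h3
  have h5 : ‖a s‖ₑ * ∫⁻ u in Ioc s t, ‖deriv b u * c (u - s)‖ₑ < ∞ := by
    rw [← lintegral_const_mul' _ _ (by simp)]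
    refine ((setLIntegral_mono_ae' measurableSet_Ioc (Eventually.of_forall fun u hu => ?_)).trans
      (lintegral_mono_set (Ioc_subset_Ioc_left hs.1.le))).trans_lt h4
    simp only [integrand, if_pos hu.1, enorm_mul, mul_assoc, le_refl]
  have ha : ‖a s‖ₑ ≠ 0 := by simpa using (h.a_pos s ⟨hs.1, hs.2.trans ht⟩).ne'
  rw [HasFiniteIntegral]
  by_contra h6
  rw [not_lt, top_le_iff] at h6
  rw [h6, ENNReal.mul_top ha] at h5
  exact lt_irrefl _ h5

/-- Away from the origin, the increments of the kernel are small in `L²`. -/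
theorem eLpNorm_sonineKernel_sub_le (h : SonineKernelBounds T β M C κ a b c) {x t : ℝ}
    (hx : 0 < x) (hxt : x ≤ t) (ht : t ≤ T) (htx : t - x ≤ x) :
    eLpNorm (sonineKernel a b c t - sonineKernel a b c x) 2 (volume.restrict (Ioc 0 x)) ≤
      ENNReal.ofReal ((M * κ + C * κ) * (t - x) ^ β) := by
  rcases hxt.eq_or_lt with rfl | hlt
  · simp
  have hd : 0 < t - x := sub_pos.2 hlt
  have hβ := h.exponent_pos
  have hC := h.C_nonneg
  have hκ := h.κ_nonneg
  have hM := h.M_nonneg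
  have hmc (t) : Measurable fun s => c (t - s) :=
    h.measurable_c.comp (measurable_const.sub measurable_id)
  have hm1 : Measurable fun s => a s * b x * (c (t - s) - c (x - s)) :=
    (h.measurable_a.mul_const _).mul ((hmc t).sub (hmc x))
  have hmK := (measurable_sonineKernel (b := b) h.measurable_a h.measurable_c t).sub
    (measurable_sonineKernel (b := b) h.measurable_a h.measurable_c x)
  -- The remainder equals `-a(s) ∫ b'(u) (c(t - s) - c(u - s)) du` over `(x, t]`: the fundamental
  -- theorem of calculus absorbs `(b(t) - b(x)) c(t - s)`, so only differences of `c` remain.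
  have e : sonineKernel a b c t - sonineKernel a b c x =
      (fun s => a s * b x * (c (t - s) - c (x - s))) -
      ((fun s => a s * b x * (c (t - s) - c (x - s))) -
        (sonineKernel a b c t - sonineKernel a b c x)) := by ext; simp
  rw [e]
  refine (eLpNorm_sub_le hm1.aestronglyMeasurable (hm1.sub hmK).aestronglyMeasurable
    (by norm_num)).trans ?_
  rw [add_mul, ENNReal.ofReal_add (by positivity) (by positivity), mul_assoc M,
    ENNReal.ofReal_mul hM]
  refine add_le_add ?_ ?_
  · refine le_trans ?_ (mul_le_mul_right (h.eLpNorm_c_sub_le x t hx.le hxt ht) _)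
    have h2 : eLpNorm (fun s => a s * b x * (c (t - s) - c (x - s))) 2
        (volume.restrict (Ioc 0 x)) ≤
        eLpNorm (fun s => M * (c (t - s) - c (x - s))) 2 (volume.restrict (Ioc 0 x)) := by
      refine eLpNorm_mono_enorm_ae ?_
      filter_upwards [ae_restrict_mem measurableSet_Ioc] with s hs
      rw [enorm_mul, enorm_mul M]
      gcongr
      refine (h.enorm_mul_le hs.1 hs.2 (hxt.trans ht) _).trans (enorm_le_enorm_of_abs_le ?_)
      exact (h.abs_mul_le x ⟨hx, hxt.trans ht⟩).trans (le_abs_self _)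
    refine h2.trans
      ((eLpNorm_const_smul_le (c := M) (f := fun s => c (t - s) - c (x - s))).trans_eq ?_)
    rw [Real.enorm_of_nonneg hM]
  · let F : ℝ → ℝ → ℝ≥0∞ := fun u s => ‖a s * deriv b u‖ₑ * ‖c (t - s) - c (u - s)‖ₑ
    have hF : Measurable (Function.uncurry F) :=
      (((h.measurable_a.comp measurable_snd).mul
        ((measurable_deriv b).comp measurable_fst)).enorm).mul
        (((hmc t).comp measurable_snd).sub
          (h.measurable_c.comp (measurable_fst.sub measurable_snd))).enorm
    have hFN : eLpNorm (fun s => ∫⁻ u in Ioc x t, F u s) 2 (volume.restrict (Ioc 0 x)) ≤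
        ENNReal.ofReal (C * κ * (t - x) ^ β) := by
      -- A bound constant in `u` suffices: `u ≥ x ≥ t - x` gives `(t - u)^β u⁻¹ ≤ (t - x)^β (t -
      -- x)⁻¹`, and the interval has length `t - x`.
      refine (eLpNorm_two_lintegral_le hF (N := fun _ =>
        ENNReal.ofReal (C * κ * ((t - x) ^ β * (t - x)⁻¹))) measurable_const ?_).trans_eq ?_
      · have hsub : Ioc x t ⊆ Ioc 0 T := Ioc_subset_Ioc hx.le ht
        filter_upwards [ae_restrict_of_ae_restrict_of_subset hsub h.abs_mul_deriv_le,
          ae_restrict_mem measurableSet_Ioc] with u hu1 hu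
        have hu0 : 0 < u := hx.trans hu.1
        have h2 : eLpNorm (F u) 2 (volume.restrict (Ioc 0 x)) ≤
            eLpNorm (fun s => (C * u⁻¹) * (c (t - s) - c (u - s))) 2
              (volume.restrict (Ioc 0 x)) := by
          refine eLpNorm_mono_enorm_ae ?_
          filter_upwards [ae_restrict_mem measurableSet_Ioc] with s hs
          simp only [F]
          rw [enorm_eq_self, enorm_mul (C * u⁻¹)]
          gcongr
          refine (h.enorm_mul_le hs.1 (hs.2.trans hu.1.le) (hu.2.trans ht) _).trans ?_
          exact enorm_le_enorm_of_abs_le (hu1.trans (le_abs_self _))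
        refine h2.trans ((eLpNorm_const_smul_le (c := C * u⁻¹)
          (f := fun s => c (t - s) - c (u - s))).trans ?_)
        rw [Real.enorm_of_nonneg (by positivity)]
        refine (mul_le_mul_right ((eLpNorm_mono_measure _ (Measure.restrict_mono
          (Ioc_subset_Ioc_right hu.1.le) le_rfl)).trans
          (h.eLpNorm_c_sub_le u t hu0.le hu.2 ht)) _).trans ?_
        rw [← ENNReal.ofReal_mul (by positivity)]
        refine ENNReal.ofReal_le_ofReal ?_
        calc C * u⁻¹ * (κ * (t - u) ^ β) = C * κ * ((t - u) ^ β * u⁻¹) := by ring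
          _ ≤ _ := by
            have h3 : 0 ≤ t - u := sub_nonneg.2 hu.2
            have h4 := hu.1.le
            have h5 : t - x ≤ u := htx.trans h4
            gcongr
      · rw [lintegral_const, Measure.restrict_apply_univ, Real.volume_Ioc,
          ← ENNReal.ofReal_mul (by positivity)]
        congr 1
        field_simp
    refine le_trans (eLpNorm_mono_enorm_ae ?_) hFN
    have hsub : Ioc 0 x ⊆ Ioc 0 t := Ioc_subset_Ioc_right hxt
    filter_upwards [ae_restrict_mem measurableSet_Ioc,
      ae_restrict_of_ae_restrict_of_subset hsub (h.ae_intervalIntegrable (hx.le.trans hxt) ht)]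
      with s hs hi
    have hi1 : IntervalIntegrable (fun u => deriv b u * c (u - s)) volume s x :=
      hi.mono_set (by
        rw [uIcc_of_le hs.2, uIcc_of_le (hs.2.trans hxt)]; exact Icc_subset_Icc_right hxt)
    have hi2 : IntervalIntegrable (fun u => deriv b u * c (u - s)) volume x t :=
      hi.mono_set (by
        rw [uIcc_of_le hxt, uIcc_of_le (hs.2.trans hxt)]; exact Icc_subset_Icc_left hs.2)
    have hi3 := h.intervalIntegrable_deriv x t hx hxt ht
    have e2 : ((fun s => a s * b x * (c (t - s) - c (x - s))) -
        (sonineKernel a b c t - sonineKernel a b c x)) s =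
        -(a s * ∫ u in Ioc x t, deriv b u * (c (t - s) - c (u - s))) := by
      rw [← intervalIntegral.integral_of_le hxt]
      simp only [mul_sub]
      rw [intervalIntegral.integral_sub (hi3.mul_const _) hi2, intervalIntegral.integral_mul_const,
        h.integral_deriv x t hx hxt ht]
      simp only [Pi.sub_apply, sonineKernel]
      rw [← intervalIntegral.integral_add_adjacent_intervals hi1 hi2]
      ring
    rw [e2, enorm_eq_self, enorm_neg, enorm_mul]
    refine (mul_le_mul_right (enorm_integral_le_lintegral_enorm _) _).trans_eq ?_
    rw [← lintegral_const_mul' _ _ (by simp)]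
    simp only [F, enorm_mul, mul_assoc]

end SonineKernelBounds

/-! ### Hölder continuity of the kernel as an `L²`-valued map -/

namespace SonineKernelBounds

variable {T β M C κ : ℝ} {a b c : ℝ → ℝ}

theorem eLpNorm_indicator_sonineKernel_le (h : SonineKernelBounds T β M C κ a b c) {t : ℝ}
    (ht0 : 0 ≤ t) (ht : t ≤ T) :
    eLpNorm ((Icc 0 t).indicator (sonineKernel a b c t)) 2 (volume.restrict (Icc 0 T)) ≤
      ENNReal.ofReal ((M * κ + C * κ / β) * t ^ β) := by
  rw [eLpNorm_indicator_eq_eLpNorm_restrict measurableSet_Icc,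
    Measure.restrict_restrict measurableSet_Icc, inter_eq_left.2 (Icc_subset_Icc_right ht),
    ← Measure.restrict_congr_set Ioc_ae_eq_Icc]
  simpa using h.eLpNorm_sonineKernel_le le_rfl ht0 ht

theorem memLp_indicator_sonineKernel (h : SonineKernelBounds T β M C κ a b c) {t : ℝ}
    (ht0 : 0 ≤ t) (ht : t ≤ T) :
    MemLp ((Icc 0 t).indicator (sonineKernel a b c t)) 2 (volume.restrict (Icc 0 T)) :=
  ⟨((measurable_sonineKernel h.measurable_a h.measurable_c t).indicator
    measurableSet_Icc).aestronglyMeasurable,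
    (h.eLpNorm_indicator_sonineKernel_le ht0 ht).trans_lt ENNReal.ofReal_lt_top⟩

/-- The map `t ↦ K(t, ·) 1_{[0, t]}` is `β`-Hölder continuous in `L²`. -/
theorem eLpNorm_indicator_sub_le (h : SonineKernelBounds T β M C κ a b c) {x t : ℝ}
    (hx : 0 ≤ x) (hxt : x ≤ t) (ht : t ≤ T) :
    eLpNorm (fun s => (Icc 0 t).indicator (sonineKernel a b c t) s -
        (Icc 0 x).indicator (sonineKernel a b c x) s) 2 (volume.restrict (Icc 0 T)) ≤
      ENNReal.ofReal ((3 * (M * κ + C * κ / β) + (M * κ + C * κ)) * (t - x) ^ β) := by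
  have hβ := h.exponent_pos
  have hC := h.C_nonneg
  have hκ := h.κ_nonneg
  have hM := h.M_nonneg
  have hd : 0 ≤ t - x := sub_nonneg.2 hxt
  set A := M * κ + C * κ / β with hA
  set B := M * κ + C * κ with hB
  have hA0 : 0 ≤ A := by positivity
  have hB0 : 0 ≤ B := by positivity
  have hp : 0 ≤ (t - x) ^ β := Real.rpow_nonneg hd β
  -- Far from the origin the increment is split at `x`. Near it, `x ≤ t - x` and `t ≤ 2 (t - x)`, so
  -- the triangle inequality costs `1 + 2 ^ β ≤ 3` times the norm bound.
  rcases le_total (t - x) x with htx | htx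
  · have hmt := measurable_sonineKernel (b := b) h.measurable_a h.measurable_c t
    have hmx := measurable_sonineKernel (b := b) h.measurable_a h.measurable_c x
    rcases hx.eq_or_lt with rfl | hx0
    · have : t = 0 := by linarith
      subst this
      simp
    have e : (fun s => (Icc 0 t).indicator (sonineKernel a b c t) s -
        (Icc 0 x).indicator (sonineKernel a b c x) s) =
        (Icc 0 x).indicator (sonineKernel a b c t - sonineKernel a b c x) +
          (Ioc x t).indicator (sonineKernel a b c t) := by
      ext s
      simp only [indicator, Pi.add_apply, Pi.sub_apply, mem_Icc, mem_Ioc]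
      grind
    rw [e]
    refine (eLpNorm_add_le ((hmt.sub hmx).indicator measurableSet_Icc).aestronglyMeasurable
      (hmt.indicator measurableSet_Ioc).aestronglyMeasurable (by norm_num)).trans ?_
    rw [eLpNorm_indicator_eq_eLpNorm_restrict measurableSet_Icc,
      eLpNorm_indicator_eq_eLpNorm_restrict measurableSet_Ioc,
      Measure.restrict_restrict measurableSet_Icc, Measure.restrict_restrict measurableSet_Ioc,
      inter_eq_left.2 (Icc_subset_Icc_right (hxt.trans ht)),
      inter_eq_left.2 (Ioc_subset_Icc_self.trans (Icc_subset_Icc hx ht)),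
      ← Measure.restrict_congr_set Ioc_ae_eq_Icc]
    refine (add_le_add (h.eLpNorm_sonineKernel_sub_le hx0 hxt ht htx)
      (h.eLpNorm_sonineKernel_le hx hxt ht)).trans ?_
    rw [← ENNReal.ofReal_add (by positivity) (by positivity)]
    refine ENNReal.ofReal_le_ofReal ?_
    nlinarith [mul_nonneg hA0 hp]
  · have e : (fun s => (Icc 0 t).indicator (sonineKernel a b c t) s -
        (Icc 0 x).indicator (sonineKernel a b c x) s) =
        (Icc 0 t).indicator (sonineKernel a b c t) -
          (Icc 0 x).indicator (sonineKernel a b c x) := rfl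
    rw [e]
    refine (eLpNorm_sub_le (h.memLp_indicator_sonineKernel (hx.trans hxt) ht).1
      (h.memLp_indicator_sonineKernel hx (hxt.trans ht)).1 (by norm_num)).trans ?_
    refine (add_le_add (h.eLpNorm_indicator_sonineKernel_le (hx.trans hxt) ht)
      (h.eLpNorm_indicator_sonineKernel_le hx (hxt.trans ht))).trans ?_
    rw [← ENNReal.ofReal_add (mul_nonneg hA0 (Real.rpow_nonneg (hx.trans hxt) _))
      (mul_nonneg hA0 (Real.rpow_nonneg hx _))]
    refine ENNReal.ofReal_le_ofReal ?_
    have h1 : x ^ β ≤ (t - x) ^ β := Real.rpow_le_rpow hx htx hβ.le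
    have h2 : t ^ β ≤ 2 * (t - x) ^ β := by
      calc t ^ β ≤ (2 * (t - x)) ^ β :=
            Real.rpow_le_rpow (hx.trans hxt) (by linarith) hβ.le
        _ = 2 ^ β * (t - x) ^ β := Real.mul_rpow (by norm_num) hd
        _ ≤ 2 ^ (1 : ℝ) * (t - x) ^ β := by
            gcongr
            · norm_num
            · exact h.exponent_le_one
        _ = _ := by rw [Real.rpow_one]
    nlinarith [mul_le_mul_of_nonneg_left h1 hA0, mul_le_mul_of_nonneg_left h2 hA0,
      mul_nonneg hB0 hp]

end SonineKernelBounds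

/-! ### From the hypotheses to the quantitative bounds -/

theorem measurePreserving_sub_left_restrict (u v : ℝ) :
    MeasurePreserving (fun s : ℝ => u - s) (volume.restrict (Ioc (u - v) u))
      (volume.restrict (Ioc 0 v)) := by
  have := (Measure.measurePreserving_sub_left volume u).restrict_preimage (measurableSet_Ico (a := 0)
    (b := v))
  rw [preimage_const_sub_Ico, sub_zero] at this
  rwa [Measure.restrict_congr_set (Ico_ae_eq_Ioc (a := (0 : ℝ)) (b := v))] at this

theorem ofReal_sqrt_le_of_le_mul_rpow {I D x γ : ℝ} (hx : 0 ≤ x) (h : I ≤ D * x ^ γ) :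
    ENNReal.ofReal √I ≤ ENNReal.ofReal (√D * x ^ (γ / 2)) := by
  refine ENNReal.ofReal_le_ofReal ((Real.sqrt_le_sqrt h).trans_eq ?_)
  rw [Real.sqrt_mul' _ (Real.rpow_nonneg hx _), Real.sqrt_eq_rpow (x ^ γ), ← Real.rpow_mul hx]
  ring_nf

/-- Reflection `s ↦ u - s` carries both norms to intervals starting at `0`; for the differences,
`(0, u]` is then enlarged to `(0, T - (v - u)]`. Square integrability of `c` is essential: without
it the real-valued integrals could take the default value `0` and bound nothing. -/
theorem HatC5.exists_eLpNorm_le {T γ : ℝ} {c : ℝ → ℝ} (hc : Measurable c)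
    (hcL : MemLp c 2 (volume.restrict (Icc 0 T))) (h : HatC5 T γ c) :
    ∃ κ : ℝ, 0 ≤ κ ∧
      (∀ u x, 0 ≤ x → x ≤ u → u ≤ T →
        eLpNorm (fun s => c (u - s)) 2 (volume.restrict (Ioc x u)) ≤
          ENNReal.ofReal (κ * (u - x) ^ (γ / 2))) ∧
      ∀ u v, 0 ≤ u → u ≤ v → v ≤ T →
        eLpNorm (fun s => c (v - s) - c (u - s)) 2 (volume.restrict (Ioc 0 u)) ≤
          ENNReal.ofReal (κ * (v - u) ^ (γ / 2)) := by
  obtain ⟨C₁, h1⟩ := h.integral_sq_le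
  obtain ⟨C₂, h2⟩ := h.integral_sq_sub_le
  refine ⟨√(max C₁ C₂), Real.sqrt_nonneg _, fun u x hx hxu hu => ?_, fun u v hu huv hv => ?_⟩
  · have hux : 0 ≤ u - x := sub_nonneg.2 hxu
    have hp := measurePreserving_sub_left_restrict u (u - x)
    rw [sub_sub_cancel] at hp
    have e := eLpNorm_comp_measurePreserving (p := 2) hc.aestronglyMeasurable hp
    rw [Function.comp_def] at e
    rw [e, eLpNorm_two_eq_ofReal_sqrt (hcL.mono_measure (Measure.restrict_mono
      (Ioc_subset_Icc_self.trans (Icc_subset_Icc_right (by linarith))) le_rfl)),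
      ← intervalIntegral.integral_of_le hux]
    refine ofReal_sqrt_le_of_le_mul_rpow hux ((h1 _ ⟨hux, by linarith⟩).trans ?_)
    gcongr
    exact le_max_left _ _
  · have hvu : 0 ≤ v - u := sub_nonneg.2 huv
    have hTu : 0 ≤ T - (v - u) := by linarith
    have hp := measurePreserving_sub_left_restrict u u
    rw [sub_self] at hp
    have hm : Measurable fun s => c (v - u + s) - c s := by fun_prop
    have e := eLpNorm_comp_measurePreserving (p := 2) hm.aestronglyMeasurable hp
    have e2 : (fun s => c (v - u + s) - c s) ∘ (fun s => u - s) =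
        fun s => c (v - s) - c (u - s) := by
      ext s
      simp only [Function.comp_apply]
      ring_nf
    rw [e2] at e
    have hp2 := (measurePreserving_add_left volume (v - u)).restrict_preimage
      (measurableSet_Ioc (a := v - u) (b := T))
    rw [preimage_const_add_Ioc, sub_self] at hp2
    have hL : MemLp (fun s => c (v - u + s) - c s) 2
        (volume.restrict (Ioc 0 (T - (v - u)))) := by
      refine MemLp.sub ?_ (hcL.mono_measure (Measure.restrict_mono
        (Ioc_subset_Icc_self.trans (Icc_subset_Icc_right (by linarith))) le_rfl))
      exact (hcL.mono_measure (Measure.restrict_mono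
        (Ioc_subset_Icc_self.trans (Icc_subset_Icc_left hvu)) le_rfl)).comp_measurePreserving hp2
    rw [e]
    refine (eLpNorm_mono_measure _ (Measure.restrict_mono
      (Ioc_subset_Ioc_right (show u ≤ T - (v - u) by linarith)) le_rfl)).trans ?_
    rw [eLpNorm_two_eq_ofReal_sqrt hL, ← intervalIntegral.integral_of_le hTu]
    refine ofReal_sqrt_le_of_le_mul_rpow hvu ((h2 _ ⟨hvu, by linarith⟩).trans ?_)
    gcongr
    exact le_max_right _ _

theorem exists_sonineKernelBounds {T γ : ℝ} {a b c : ℝ → ℝ} (ha : Measurable a)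
    (hc : Measurable c) (h1 : HatC1 T a b c) (h2 : HatC2 T a b) (h4 : HatC4 T a b)
    (h5 : HatC5 T γ c) : ∃ M C κ : ℝ, SonineKernelBounds T (γ / 2) M C κ a b c := by
  obtain ⟨M, hM⟩ := h1.bounded_ab
  obtain ⟨C, hC⟩ := h4
  obtain ⟨κ, hκ, hκ1, hκ2⟩ := h5.exists_eLpNorm_le hc h1.memLp_c
  have hAC {x t : ℝ} (hx : 0 < x) (hxt : x ≤ t) (ht : t ≤ T) (hxT : x < T) :
      AbsolutelyContinuousOnInterval b x t :=
    (h1.absolutelyContinuous_b x ⟨hx, hxT⟩).mono (by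
      rw [uIcc_of_le hxt, uIcc_of_le hxT.le]; exact Icc_subset_Icc_right ht)
  refine ⟨max M 0, max C 0, κ, ha, hc, half_pos h5.exponent_mem.1,
    by linarith [h5.exponent_mem.2], le_max_right _ _, le_max_right _ _, hκ, fun s hs => ?_,
    h1.monotone_a.mono Ioc_subset_Icc_self,
    fun t ht => (hM t ⟨ht.1.le, ht.2⟩).trans (le_max_left _ _), ?_, hκ1, hκ2,
    fun x t hx hxt ht => ?_, fun x t hx hxt ht => ?_⟩
  -- Positivity almost everywhere yields a point of `(0, s)` where `a` is positive, and monotonicity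
  -- propagates it to `s`.
  · have hsub : Ioo 0 s ⊆ Icc 0 T := Ioo_subset_Icc_self.trans (Icc_subset_Icc_right hs.2)
    have hne : (ae (volume.restrict (Ioo 0 s))).NeBot := by
      rw [ae_neBot, Ne, Measure.restrict_eq_zero, Real.volume_Ioo, sub_zero,
        ENNReal.ofReal_eq_zero, not_le]
      exact hs.1
    obtain ⟨r, hr, hrs⟩ := ((ae_restrict_of_ae_restrict_of_subset hsub h2).and
      (ae_restrict_mem measurableSet_Ioo)).exists
    exact hr.1.trans_le (h1.monotone_a (hsub hrs) (Ioc_subset_Icc_self hs) hrs.2.le)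
  · filter_upwards [ae_restrict_of_ae_restrict_of_subset Ioc_subset_Icc_self hC,
      ae_restrict_mem measurableSet_Ioc] with u hu hu0
    refine hu.trans ?_
    have := hu0.1
    gcongr
    exact le_max_left _ _
  -- Absolute continuity is given only from a left end point below `T`; the remaining case `x = t =
  -- T` is a degenerate interval.
  · rcases (hxt.trans ht).lt_or_eq with hxT | rfl
    · exact (hAC hx hxt ht hxT).intervalIntegrable_deriv
    · obtain rfl := le_antisymm hxt ht
      exact .refl
  · rcases (hxt.trans ht).lt_or_eq with hxT | rfl
    · exact (hAC hx hxt ht hxT).integral_deriv_eq_sub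
    · obtain rfl := le_antisymm hxt ht
      simp

/-! ### Variance bound and Hölder modification -/

theorem mainTheorem8 (T : ℝ) (hT : 0 < T) (a b c : ℝ → ℝ)
    (ha : Measurable a) (hb : Measurable b) (hc : Measurable c)
    (h1 : HatC1 T a b c) (h2 : HatC2 T a b) (h3 : HatC3 T c) (h4 : HatC4 T a b)
    (γ : ℝ) (h5 : HatC5 T γ c) :
    ∃ C : ℝ, ∀ (Ω : Type*) [MeasurableSpace Ω] (P : Measure Ω) [IsProbabilityMeasure P]
      (W : Icc (0 : ℝ) T → Ω → ℝ), IsWienerProcess W P →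
      (∃ Y : Icc (0 : ℝ) T → Ω → ℝ, IsVolterraProcess W P (sonineKernel a b c) Y) ∧
      ∀ Y : Icc (0 : ℝ) T → Ω → ℝ, IsVolterraProcess W P (sonineKernel a b c) Y →
        (∀ t₁ t₂ : Icc (0 : ℝ) T, t₁ ≤ t₂ →
          ∫ ω, (Y t₂ ω - Y t₁ ω) ^ 2 ∂P ≤ C * ((t₂ : ℝ) - (t₁ : ℝ)) ^ γ) ∧
        ∃ Y' : Icc (0 : ℝ) T → Ω → ℝ,
          (∀ t, Y' t =ᵐ[P] Y t) ∧
          ∀ᵐ ω ∂P, ∀ δ : ℝ≥0, 0 < δ → (δ : ℝ) < γ / 2 →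
            ∃ L : ℝ≥0, HolderWith L δ (fun t => Y' t ω) := by
  obtain ⟨M, C, κ, hK⟩ := exists_sonineKernelBounds ha hc h1 h2 h4 h5
  set D := 3 * (M * κ + C * κ / (γ / 2)) + (M * κ + C * κ) with hD
  have hD0 : 0 ≤ D := by
    have := hK.exponent_pos
    have := hK.C_nonneg
    have := hK.κ_nonneg
    have := hK.M_nonneg
    positivity
  -- `D` is the Hölder constant of the kernel map in `L²`, fixed before the probability space; the
  -- second moment squares it.
  refine ⟨D ^ 2, fun Ω _ P _ W hW => ⟨?_, fun Y hY => ?_⟩⟩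
  · choose Y hY using fun t : Icc (0 : ℝ) T =>
      hW.exists_isWienerIntegral hT (hK.memLp_indicator_sonineKernel t.2.1 t.2.2)
    exact ⟨Y, hY⟩
  have hinc (s t : Icc (0 : ℝ) T) (hst : s ≤ t) :
      eLpNorm (fun ω => Y t ω - Y s ω) 2 P ≤ ENNReal.ofReal (D * ((t : ℝ) - s) ^ (γ / 2)) := by
    rw [(hY t).eLpNorm_sub hW (hY s)]
    exact hK.eLpNorm_indicator_sub_le s.2.1 hst t.2.2
  refine ⟨fun s t hst => ?_, ?_⟩
  · have h := hinc s t hst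
    have hd : (0 : ℝ) ≤ t - s := sub_nonneg.2 hst
    have hm : MemLp (fun ω => Y t ω - Y s ω) 2 P := (hY t).2.1.sub (hY s).2.1
    rw [eLpNorm_two_eq_ofReal_sqrt hm, ENNReal.ofReal_le_ofReal_iff (by positivity),
      Real.sqrt_le_iff, mul_pow, ← Real.rpow_natCast (_ ^ (γ / 2)), ← Real.rpow_mul hd] at h
    refine h.2.trans_eq ?_
    congr 2
    push_cast
    ring
  · refine exists_modification_holderWith hT hK.exponent_pos (fun t => (hY t).2.1.1) fun q => ?_
    -- The `q`-th moment constant is the standard Gaussian `L^q` norm, which is finite, times the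
    -- `L²` constant.
    refine ⟨(eLpNorm id q (gaussianReal 0 1)).toReal * D, by positivity, fun s t hst => ?_⟩
    refine ((hY t).eLpNorm_sub_le hT.le hW (hY s) (ENNReal.natCast_ne_top q)).trans ?_
    rw [mul_assoc, ENNReal.ofReal_mul ENNReal.toReal_nonneg,
      ENNReal.ofReal_toReal (memLp_id_gaussianReal' q (ENNReal.natCast_ne_top q)).2.ne]
    gcongr
    exact hinc s t hst
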